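/- Let $F/\mathbb F_q$ be an algebraic function field, i.e. a finite extension of a rational function field $\mathbb F_q(x)$, of genus $g(F)$. For a place $P$ let $v_P$ be its normalised discrete valuation. Let $m\ge 1$ and suppose that $F/\mathbb F_q$ is $m$-friendly: $g(F)=m-1$, and there are a place $Q$ of $F$ and a function $z_1\in F$ with $v_Q(z_1)=1$ and $\deg((z_1)_\infty)=2$, where $(\cdot)_\infty$ denotes the pole divisor. Put $f_i=z_1^{i-1}$ and $g_j=z_1^{m-j}$ for $1\le i,j\le m$. Functions $f'_1,\dots,f'_m,g'_1,\dots,g'_m\in F$ are said to form a Matdot AG code over $F$ if there are a place $Q'$ and an integer $d$ such that $v_{Q'}(f'_ig'_j)=d$ if and only if $i=j$. The recovery threshold of such a code is $\deg((h)_\infty)+1$, where $(h)_\infty$ is the pole divisor of $h=\sum_{i,j}A_iB_jf'_ig'_j$ for general $A_i,B_j$, that is, the least common multiple of the divisors $(f'_ig'_j)_\infty$. Then: 1. $v_Q(f_ig_j)=m-1$ if and only if $i=j$; hence the $f_i$ and $g_j$ form a Matdot AG code at $Q$. 2. The recovery threshold of this code is $R=2g(F)+2m-1$. 3. $R$ is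 optimal: it is the minimum of the recovery thresholds of all Matdot AG codes $f'_1,\dots,f'_m,g'_1,\dots,g'_m$ over $F$. 4. Let $r,n,t\ge 0$, and let $A=(A_1,\dots,A_m)\in\mathbb F_q^{r\times mn}$ and $B=(B_1;\dots;B_m)\in\mathbb F_q^{mn\times t}$ be partitioned into $m$ blocks $A_i\in\mathbb F_q^{r\times n}$, $B_j\in\mathbb F_q^{n\times t}$. Put $f=\sum_iA_if_i$, $g=\sum_jB_jg_j$ and $h=fg$. * There are unique matrices $C_0,\dots,C_{2m-2}\in\mathbb F_q^{r\times t}$ with $h=\sum_{l=0}^{2m-2}C_lz_1^l$, and $C_{m-1}=\sum_iA_iB_i=AB$. * $\deg((h)_\infty)+1\le R$, with equality if $A_mB_1\ne0$. * If $S$ is a finite set of at least $R$ rational places that are not poles of $z_1$, then the answers $f(P)g(P)$, $P\in S$, of the worker nodes determine $h$ and $AB$: if two pairs $(A,B)$, $(A',B')$ have the same answers at all $P\in S$, then their functions $h$ coincide and $AB=A'B'$. * Suppose $r,n,t\ge1$. If $S$ is a finite set of fewer than $R$ rational places that are not poles of $z_1$, and for each $P\in S$ there is a $P'\in S$, $P'\neq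 P$, with $z_1(P')=z_1(P)$, then the answers at $S$ do not determine $h$: some two pairs $(A,B)$, $(A',B')$ have the same answers at all $P\in S$ but different functions $h$. -/

import Mathlib

open scoped WithZero

namespace MatdotAG

noncomputable section

/-- A place of `F/k`, given by its valuation ring: a discrete valuation ring of `F` that contains
the constants `k`. -/
structure Place (k F : Type*) [Field k] [Field F] [Algebra k F] where
  /-- the valuation ring of the place -/
  ring : ValuationSubring F
  algebraMap_mem : ∀ c : k, algebraMap k F c ∈ ring
  isDVR : IsDiscreteValuationRing ring

namespace Place

variable {k F : Type*} [Field k] [Field F] [Algebra k F]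

instance (P : Place k F) : IsDiscreteValuationRing P.ring := P.isDVR

instance (P : Place k F) : Algebra k P.ring :=
  ((algebraMap k F).codRestrict P.ring.toSubring P.algebraMap_mem).toAlgebra

/-- The residue class field of the place `P`. -/
abbrev Residue (P : Place k F) : Type _ := IsLocalRing.ResidueField P.ring

/-- The degree of the place `P`: the dimension of its residue class field over `k`. -/
def degree (P : Place k F) : ℕ := Module.finrank k P.Residue

/-- The multiplicative valuation of `F` with valuation ring that of `P`, normalised by giving a
uniformizer the value `exp (-1)`. -/
def val (P : Place k F) : Valuation F ℤᵐ⁰ :=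
  (IsDiscreteValuationRing.maximalIdeal P.ring).valuation F

open Classical in
/-- The normalised discrete valuation `v_P`, with `v_P(0) = ∞`. -/
def ord (P : Place k F) (x : F) : WithTop ℤ :=
  if x = 0 then ⊤ else ((-WithZero.log (P.val x) : ℤ) : WithTop ℤ)

/-- The coefficient of `P` in the pole divisor `(x)_∞`, that is `max (0, -v_P(x))`;
it is `0` for `x = 0`. -/
def poleOrder (P : Place k F) (x : F) : ℕ := (WithZero.log (P.val x)).toNat

open Classical in
/-- The value `x(P)` in the residue class field, for `x` without a pole at `P`
(and `0` if `x` has a pole at `P`). -/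
def eval (P : Place k F) (x : F) : P.Residue :=
  if hx : x ∈ P.ring then IsLocalRing.residue P.ring ⟨x, hx⟩ else 0

theorem neg_le_ord_iff (P : Place k F) (x : F) (n : ℤ) :
    ((-n : ℤ) : WithTop ℤ) ≤ P.ord x ↔ P.val x ≤ WithZero.exp n := by
  unfold ord
  split_ifs with hx
  · simp [hx]
  · rw [WithTop.coe_le_coe, neg_le_neg_iff,
      WithZero.log_le_iff_le_exp ((P.val.ne_zero_iff).2 hx)]

theorem val_algebraMap_le_one (P : Place k F) (c : k) : P.val (algebraMap k F c) ≤ 1 :=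
  (IsDiscreteValuationRing.maximalIdeal P.ring).valuation_le_one
    (⟨algebraMap k F c, P.algebraMap_mem c⟩ : P.ring)

end Place

section Divisors

variable (k F : Type*) [Field k] [Field F] [Algebra k F]

/-- Divisors of `F/k`: finite formal sums of places with integer coefficients. -/
abbrev Divisor : Type _ := Place k F →₀ ℤ

variable {k F}

/-- The degree of a divisor. -/
def Divisor.degree (D : Divisor k F) : ℤ := D.sum fun P n => n * (P.degree : ℤ)

/-- The Riemann-Roch space `L(D)` of all `x` with `x = 0` or `(x) + D ≥ 0`. -/
def riemannRochSpace (D : Divisor k F) : Submodule k F where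
  carrier := {x | ∀ P : Place k F, ((-(D P) : ℤ) : WithTop ℤ) ≤ P.ord x}
  zero_mem' := fun P => by simp [Place.ord]
  add_mem' := fun {x y} hx hy P => by
    have h1 := (P.neg_le_ord_iff x _).1 (hx P)
    have h2 := (P.neg_le_ord_iff y _).1 (hy P)
    exact (P.neg_le_ord_iff _ _).2 (P.val.map_add_le h1 h2)
  smul_mem' := fun c x hx P => by
    have h1 := (P.neg_le_ord_iff x _).1 (hx P)
    refine (P.neg_le_ord_iff _ _).2 ?_
    rw [Algebra.smul_def, map_mul]
    exact (mul_le_of_le_one_left' (P.val_algebraMap_le_one c)).trans h1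

variable (k F) in
/-- `g` is the genus of `F/k`: the maximum of `deg D - ℓ(D) + 1` over all divisors `D`. -/
def IsGenus (g : ℤ) : Prop :=
  IsGreatest
    {n : ℤ | ∃ D : Divisor k F,
      n = D.degree - (Module.finrank k (riemannRochSpace D) : ℤ) + 1} g

variable (k) in
/-- The degree of the least common multiple of the pole divisors `(x_i)_∞` of a finite family.
For a matrix of functions, indexed by its entries, this is the degree of its pole divisor. -/
def polesDegree {ι : Type*} [Fintype ι] (x : ι → F) : ℕ :=
  ∑ᶠ P : Place k F, (Finset.univ.sup fun i => P.poleOrder (x i)) * P.degree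

/-- `F/k` is `m`-friendly, with `Q` and `z` as the place and the function that show it:
the genus is `m - 1`, `v_Q(z) = 1` and `deg (z)_∞ = 2`. -/
structure IsFriendly (m : ℕ) (Q : Place k F) (z : F) : Prop where
  genus : IsGenus k F ((m : ℤ) - 1)
  ord_eq : Q.ord z = ((1 : ℤ) : WithTop ℤ)
  poles : polesDegree k (fun _ : Unit => z) = 2

/-- `f_1, …, f_m` and `g_1, …, g_m` form a Matdot AG code at the place `Q`: for some integer `d`,
the products of value `d` at `Q` are exactly the `m` diagonal ones. -/
def IsMatdotCode {m : ℕ} (Q : Place k F) (f g : Fin m → F) : Prop :=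
  ∃ d : ℤ, ∀ i j : Fin m, Q.ord (f i * g j) = (d : WithTop ℤ) ↔ i = j

variable (k) in
/-- The recovery threshold `deg (h)_∞ + 1` of the code given by the `f_i` and `g_j`. Here
`(h)_∞` is the pole divisor of `h = ∑ A_i B_j f_i g_j` with the `A_i`, `B_j` taken as
indeterminates, that is the least common multiple of the `(f_i g_j)_∞`. -/
def recoveryThreshold {m : ℕ} (f g : Fin m → F) : ℕ :=
  polesDegree k (fun p : Fin m × Fin m => f p.1 * g p.2) + 1

end Divisors

section Coding

variable {k F : Type*} [Field k] [Field F] [Algebra k F] {m n r t : ℕ}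

/-- The block `A_i` of `A = (A_1, …, A_m)`. -/
def blockCol (A : Matrix (Fin r) (Fin (m * n)) k) (i : Fin m) : Matrix (Fin r) (Fin n) k :=
  A.submatrix id fun l => finProdFinEquiv (i, l)

/-- The block `B_j` of the matrix `B` with the blocks `B_1, …, B_m` below each other. -/
def blockRow (B : Matrix (Fin (m * n)) (Fin t) k) (j : Fin m) : Matrix (Fin n) (Fin t) k :=
  B.submatrix (fun l => finProdFinEquiv (j, l)) id

/-- `f = ∑ A_i f_i`. -/
def encodeLeft (f : Fin m → F) (A : Matrix (Fin r) (Fin (m * n)) k) : Matrix (Fin r) (Fin n) F :=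
  ∑ i, f i • (blockCol A i).map (algebraMap k F)

/-- `g = ∑ B_j g_j`. -/
def encodeRight (g : Fin m → F) (B : Matrix (Fin (m * n)) (Fin t) k) : Matrix (Fin n) (Fin t) F :=
  ∑ j, g j • (blockRow B j).map (algebraMap k F)

/-- `h = f g = ∑ A_i B_j f_i g_j`. -/
def encodeProd (f g : Fin m → F) (A : Matrix (Fin r) (Fin (m * n)) k)
    (B : Matrix (Fin (m * n)) (Fin t) k) : Matrix (Fin r) (Fin t) F :=
  encodeLeft f A * encodeRight g B

/-- The answer `f(P) g(P)` of the worker node at the place `P`. -/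
def response (f g : Fin m → F) (P : Place k F) (A : Matrix (Fin r) (Fin (m * n)) k)
    (B : Matrix (Fin (m * n)) (Fin t) k) : Matrix (Fin r) (Fin t) P.Residue :=
  (encodeLeft f A).map P.eval * (encodeRight g B).map P.eval

end Coding

end

end MatdotAG

namespace MatdotAG

noncomputable section

/-! The products of the code are powers of `z` with exponents from `0` to `2m - 2`, and `z ^ (2m -
2)` has pole divisor `(2m - 2)(z)_∞`. Its degree is `4m - 4`, so the threshold is `4m - 3`, which is
`2g + 2m - 1` for `g = m - 1`.

For optimality, the `m` left functions of any Matdot code have distinct values at its place. They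
are therefore independent, and the least divisor `D` bounding their poles has `ℓ(D) ≥ m > g`. A
Clifford-type bound (`IsGenus.two_mul_le_degree`) gives `deg D ≥ 2g`. The same holds on the right,
and the poles of the products dominate the sum of the two divisors.

The Clifford-type bound avoids duality. With `E = (z)_∞` of degree 2, the spaces `z L(A)` and `L(A)`
lie in `L(A + E)` and meet inside `z L(A - E)`, so `n ↦ ℓ(D + nE)` is convex. If `deg D < 2g <
2ℓ(D)`, its total growth up to some large `N` is below `2N`. Convexity then makes every increment to
the left of `D` at most 1, so `L(D - gE) ≠ 0` although `deg (D - gE) < 0`.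

Recovery holds because a nonzero function cannot have more zeros than the degree of a divisor
bounding its poles. Recovery fails for paired places because their at most `2m - 2` values of `z`
are roots of a product `p q` with both degrees below `m`, and `p(z) q(z)` is a possible `h`. -/

theorem exists_aeval_eq_of_mem_adjoin {k F : Type*} [Field k] [Field F] [Algebra k F] {t x : F}
    (hx : x ∈ Algebra.adjoin k {t}) : ∃ p : Polynomial k, Polynomial.aeval t p = x := by
  rwa [Algebra.adjoin_singleton_eq_range_aeval] at hx

namespace Place

/-! ### Valuations and transcendence at a place -/

section Basic

variable {k F : Type*} [Field k] [Field F] [Algebra k F] (P : Place k F)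

theorem val_le_one_iff {x : F} : P.val x ≤ 1 ↔ x ∈ P.ring := by
  constructor
  · intro h
    obtain ⟨a, rfl⟩ := IsDiscreteValuationRing.exists_lift_of_le_one h
    exact a.2
  · intro h
    exact (IsDiscreteValuationRing.maximalIdeal P.ring).valuation_le_one (⟨x, h⟩ : P.ring)

theorem residue_eq_zero_iff (x : P.ring) :
    IsLocalRing.residue P.ring x = 0 ↔ P.val (x : F) < 1 := by
  rw [IsLocalRing.residue_eq_zero_iff]
  exact ((IsDiscreteValuationRing.maximalIdeal P.ring).valuation_lt_one_iff_mem (K := F) x).symm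

theorem exists_val_eq_exp_neg_one : ∃ π : F, P.val π = WithZero.exp (-1) :=
  (IsDiscreteValuationRing.maximalIdeal P.ring).valuation_exists_uniformizer F

theorem val_algebraMap {c : k} (hc : c ≠ 0) : P.val (algebraMap k F c) = 1 := by
  refine le_antisymm (P.val_algebraMap_le_one c) ?_
  have h := P.val_algebraMap_le_one c⁻¹
  rw [map_inv₀, map_inv₀] at h
  have h0 : P.val (algebraMap k F c) ≠ 0 := by simpa using hc
  exact (inv_le_one₀ (zero_lt_iff.2 h0)).1 h

instance : IsScalarTower k P.ring F := IsScalarTower.of_algebraMap_eq fun _ => rfl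

/-- A valuation ring is integrally closed. -/
theorem mem_ring_of_isIntegral {R : Subalgebra k F} (hR : ∀ x ∈ R, x ∈ P.ring) {y : F}
    (hy : IsIntegral R y) : y ∈ P.ring := by
  let φ : R →+* P.ring := R.val.toRingHom.codRestrict P.ring.toSubring fun x => hR x x.2
  obtain ⟨p, hp, hpy⟩ := hy
  have : IsIntegral P.ring y := ⟨p.map φ, hp.map φ, by rw [Polynomial.eval₂_map]; exact hpy⟩
  obtain ⟨a, rfl⟩ := IsIntegrallyClosed.isIntegral_iff.1 this
  exact a.2

theorem coe_aeval (x : P.ring) (q : Polynomial k) :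
    ((Polynomial.aeval x q : P.ring) : F) = Polynomial.aeval (x : F) q :=
  (Polynomial.aeval_algebraMap_apply F x q).symm

theorem aeval_mem_ring {x : F} (hx : x ∈ P.ring) (q : Polynomial k) :
    Polynomial.aeval x q ∈ P.ring := by
  have h := P.coe_aeval ⟨x, hx⟩ q
  exact h ▸ (Polynomial.aeval (⟨x, hx⟩ : P.ring) q).2

theorem val_aeval_eq_one {x : F} (hx : P.val x < 1) {p : Polynomial k} (hp : p.coeff 0 ≠ 0) :
    P.val (Polynomial.aeval x p) = 1 := by
  have hmem : ∀ q : Polynomial k, P.val (Polynomial.aeval x q) ≤ 1 := by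
    intro q
    exact P.val_le_one_iff.2 (P.aeval_mem_ring (P.val_le_one_iff.1 hx.le) q)
  conv_lhs => rw [← Polynomial.X_mul_divX_add p]
  rw [map_add, map_mul, Polynomial.aeval_X, Polynomial.aeval_C]
  rw [P.val.map_add_eq_of_lt_right, P.val_algebraMap hp]
  rw [P.val_algebraMap hp, map_mul]
  exact mul_lt_one_of_lt_of_le hx (hmem _)

/-- After a power of `X` is split off, a polynomial has nonzero constant term, and its value at `x`
is then a unit at `P`. -/
theorem transcendental_of_val_lt_one {x : F} (h0 : x ≠ 0) (hx : P.val x < 1) :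
    Transcendental k x := by
  rw [transcendental_iff]
  intro p hp
  by_contra hp0
  obtain ⟨q, hq, hq0⟩ := Polynomial.exists_eq_pow_rootMultiplicity_mul_and_not_dvd p hp0 0
  rw [hq, map_mul, mul_eq_zero] at hp
  rcases hp with hp | hp
  · simp at hp
    exact h0 hp.1
  · have h1 := P.val_aeval_eq_one hx (p := q) (by
      simpa [Polynomial.X_dvd_iff] using hq0)
    rw [hp, map_zero] at h1
    exact zero_ne_one h1

end Basic

/-! ### Residue fields are finite over the constants -/

section Residue

variable {k F : Type*} [Field k] [Field F] [Algebra k F] (P : Place k F)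

/-- Modulo the maximal ideal `t` vanishes, so a relation reduces to its constant coefficients, which
are zero by independence of the residues. Dividing the relation by `t` shifts the coefficients, and
induction on `n` reaches all of them. -/
theorem coeff_eq_zero_of_sum_aeval_mul_eq_zero {t : F} (h0 : t ≠ 0) (ht : P.val t < 1)
    {ι : Type*} (s : Finset ι) {u : ι → P.ring}
    (hu : LinearIndependent k fun i => IsLocalRing.residue P.ring (u i)) (n : ℕ) :
    ∀ p : ι → Polynomial k, ∑ i ∈ s, Polynomial.aeval t (p i) * (u i : F) = 0 →
      ∀ i ∈ s, (p i).coeff n = 0 := by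
  let t' : P.ring := ⟨t, P.val_le_one_iff.1 ht.le⟩
  have key : ∀ p : ι → Polynomial k, ∑ i ∈ s, Polynomial.aeval t (p i) * (u i : F) = 0 →
      ∀ i ∈ s, (p i).coeff 0 = 0 := by
    intro p hp
    have h1 : ∑ i ∈ s, Polynomial.aeval t' (p i) * u i = 0 := by
      apply Subtype.val_injective
      simp only [AddSubmonoidClass.coe_finsetSum, MulMemClass.coe_mul, ZeroMemClass.coe_zero]
      rw [← hp]
      refine Finset.sum_congr rfl fun i _ => ?_
      congr 1
      exact P.coe_aeval t' (p i)
    have h2 := congrArg (IsLocalRing.residue P.ring) h1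
    rw [map_sum, map_zero] at h2
    have ht0 : IsLocalRing.residue P.ring t' = 0 := (P.residue_eq_zero_iff t').2 ht
    refine linearIndependent_iff'.1 hu s (fun i => (p i).coeff 0) ?_
    rw [← h2]
    refine Finset.sum_congr rfl fun i _ => ?_
    conv_rhs => rw [← Polynomial.X_mul_divX_add (p i)]
    rw [map_mul, map_add, map_mul, Polynomial.aeval_X, Polynomial.aeval_C, map_add, map_mul,
      ht0, zero_mul, zero_add, Algebra.smul_def]
    rfl
  induction n with
  | zero => exact key
  | succ n ih =>
    intro p hp i hi
    have h1 := key p hp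
    rw [← Polynomial.coeff_divX]
    refine ih (fun i => (p i).divX) ?_ i hi
    apply mul_left_cancel₀ h0
    rw [mul_zero, ← hp, Finset.mul_sum]
    refine Finset.sum_congr rfl fun i hi => ?_
    conv_rhs => rw [← Polynomial.X_mul_divX_add (p i), h1 i hi]
    simp [mul_assoc]

open IntermediateField.algebraAdjoinAdjoin in
theorem linearIndependent_of_residue {t : F} (h0 : t ≠ 0) (ht : P.val t < 1)
    {ι : Type*} {u : ι → P.ring}
    (hu : LinearIndependent k fun i => IsLocalRing.residue P.ring (u i)) :
    LinearIndependent (IntermediateField.adjoin k {t}) fun i => (u i : F) := by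
  rw [← LinearIndependent.iff_fractionRing (Algebra.adjoin k {t}), linearIndependent_iff']
  intro s a ha i hi
  choose p hp using fun i => exists_aeval_eq_of_mem_adjoin (a i).2
  have h1 : p i = 0 := by
    ext n
    refine P.coeff_eq_zero_of_sum_aeval_mul_eq_zero h0 ht s hu n p ?_ i hi
    rw [← ha]
    refine Finset.sum_congr rfl fun j _ => ?_
    rw [hp, Subalgebra.smul_def, smul_eq_mul]
  apply Subtype.val_injective
  rw [← hp, h1, map_zero]; rfl

variable [Algebra (RatFunc k) F] [IsScalarTower k (RatFunc k) F] [FunctionField k F]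

/-- A uniformizer `t` is transcendental, so `F` is finite over `k(t)`. Lifts of a residue basis stay
independent over `k(t)`, so the basis is finite. -/
theorem finite_residue : Module.Finite k P.Residue := by
  obtain ⟨t, ht⟩ := P.exists_val_eq_exp_neg_one
  have h0 : t ≠ 0 := by
    rintro rfl
    rw [map_zero] at ht
    exact WithZero.exp_ne_zero ht.symm
  have ht1 : P.val t < 1 := by rw [ht, ← WithZero.exp_zero, WithZero.exp_lt_exp]; norm_num
  have := FunctionField.finiteDimensional_of_adjoin_transcendental
    (P.transcendental_of_val_lt_one h0 ht1)
  let b := Module.Basis.ofVectorSpace k P.Residue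
  choose u hu using fun i => IsLocalRing.residue_surjective (b i)
  have hb : LinearIndependent k fun i => IsLocalRing.residue P.ring (u i) := by
    simp_rw [hu]; exact b.linearIndependent
  have := (P.linearIndependent_of_residue h0 ht1 hb).finite
  exact Module.Finite.of_basis b

theorem degree_pos : 0 < P.degree := by
  have := P.finite_residue
  exact Module.finrank_pos

/-- Every `y` is regular away from the poles of `z` and the zeros of some polynomial in `z`. -/
theorem exists_polynomial_mem_ring {z : F} (hz : Transcendental k z) (y : F) :
    ∃ p : Polynomial k, p ≠ 0 ∧ ∀ P : Place k F, z ∈ P.ring →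
      1 ≤ P.val (Polynomial.aeval z p) → y ∈ P.ring := by
  have := FunctionField.finiteDimensional_of_adjoin_transcendental hz
  have hy : IsAlgebraic (IntermediateField.adjoin k {z}) y := Algebra.IsAlgebraic.isAlgebraic y
  have hy' : IsAlgebraic (Algebra.adjoin k {z}) y := by
    open IntermediateField.algebraAdjoinAdjoin in
    exact (IsFractionRing.isAlgebraic_iff (Algebra.adjoin k {z})
      (IntermediateField.adjoin k {z}) F).2 hy
  -- Clearing denominators: a nonzero `b = p(z)` makes `b • y` integral over `k[z]`, hence regular
  -- wherever `z` is.
  obtain ⟨b, hb0, hb⟩ := hy'.exists_integral_multiple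
  obtain ⟨p, hp'⟩ := exists_aeval_eq_of_mem_adjoin b.2
  refine ⟨p, ?_, fun P hzP hP => ?_⟩
  · rintro rfl
    rw [map_zero] at hp'
    exact hb0 (Subtype.val_injective hp'.symm)
  · have hR : ∀ x ∈ Algebra.adjoin k {z}, x ∈ P.ring := by
      intro x hx
      obtain ⟨q, rfl⟩ := exists_aeval_eq_of_mem_adjoin hx
      exact P.aeval_mem_ring hzP q
    have h1 := P.mem_ring_of_isIntegral hR hb
    rw [Subalgebra.smul_def, smul_eq_mul, ← P.val_le_one_iff, map_mul, ← hp'] at h1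
    rw [← P.val_le_one_iff]
    exact (le_mul_of_one_le_left' hP).trans h1

end Residue

end Place

/-! ### Riemann-Roch spaces and their growth -/

section RiemannRochSpaces

variable {k F : Type*} [Field k] [Field F] [Algebra k F]

theorem mem_riemannRochSpace {D : Divisor k F} {x : F} :
    x ∈ riemannRochSpace D ↔ ∀ P : Place k F, P.val x ≤ WithZero.exp (D P) :=
  forall_congr' fun P => P.neg_le_ord_iff x _

theorem riemannRochSpace_mono {D D' : Divisor k F} (h : D ≤ D') :
    riemannRochSpace D ≤ riemannRochSpace D' := fun _ hx =>
  mem_riemannRochSpace.2 fun P =>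
    (mem_riemannRochSpace.1 hx P).trans (WithZero.exp_le_exp.2 (h P))

theorem Divisor.degree_zero : (0 : Divisor k F).degree = 0 := Finsupp.sum_zero_index

theorem Divisor.degree_add (D D' : Divisor k F) : (D + D').degree = D.degree + D'.degree :=
  Finsupp.sum_add_index' (fun _ => by simp) fun _ _ _ => by ring

theorem Divisor.degree_neg (D : Divisor k F) : (-D).degree = -D.degree := by
  have h := Divisor.degree_add D (-D)
  rw [add_neg_cancel, Divisor.degree_zero] at h
  linarith

theorem Divisor.degree_sub (D D' : Divisor k F) : (D - D').degree = D.degree - D'.degree := by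
  rw [sub_eq_add_neg, Divisor.degree_add, Divisor.degree_neg]; ring

theorem Divisor.degree_smul (n : ℤ) (D : Divisor k F) : (n • D).degree = n * D.degree := by
  unfold Divisor.degree
  rw [Finsupp.sum_smul_index (fun _ => by simp), Finsupp.mul_sum]
  exact Finsupp.sum_congr fun _ _ => by ring

theorem Divisor.degree_single (P : Place k F) (n : ℤ) :
    Divisor.degree (Finsupp.single P n) = n * P.degree :=
  Finsupp.sum_single_index (by simp)

theorem Divisor.degree_mono {D D' : Divisor k F} (h : D ≤ D') : D.degree ≤ D'.degree := by
  have h1 : 0 ≤ (D' - D).degree :=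
    Finset.sum_nonneg fun P _ => mul_nonneg (by simpa using h P) (by positivity)
  rw [Divisor.degree_sub] at h1
  linarith

theorem finrank_riemannRochSpace_le_of_mul {A B : Divisor k F} {w : F} (hw : w ≠ 0)
    (h : ∀ P : Place k F, P.val w ≤ WithZero.exp (B P - A P))
    [Module.Finite k (riemannRochSpace B)] :
    Module.finrank k (riemannRochSpace A) ≤ Module.finrank k (riemannRochSpace B) := by
  have hmem : ∀ x ∈ riemannRochSpace A, LinearMap.mulLeft k w x ∈ riemannRochSpace B := by
    intro x hx
    rw [mem_riemannRochSpace] at hx ⊢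
    intro P
    rw [LinearMap.mulLeft_apply, map_mul, show B P = (B P - A P) + A P by ring, WithZero.exp_add]
    exact mul_le_mul' (h P) (hx P)
  refine LinearMap.finrank_le_finrank_of_injective
    (f := (LinearMap.mulLeft k w).restrict hmem) fun x y hxy => ?_
  have h1 := congrArg Subtype.val hxy
  exact Subtype.val_injective (mul_left_cancel₀ hw h1)

section Step

variable (D : Divisor k F) (P : Place k F)

theorem mul_mem_ring_of_val_eq {π : F} (hπ : P.val π = WithZero.exp (-(D P + 1))) {x : F}
    (hx : x ∈ riemannRochSpace (D + Finsupp.single P 1)) : π * x ∈ P.ring := by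
  have h := mem_riemannRochSpace.1 hx P
  rw [Finsupp.add_apply, Finsupp.single_eq_same] at h
  rw [← P.val_le_one_iff, map_mul, hπ, ← WithZero.exp_zero,
    show (0 : ℤ) = -(D P + 1) + (D P + 1) by ring, WithZero.exp_add (-(D P + 1))]
  exact mul_le_mul_right h _

/-- The leading coefficient at `P` of the elements of `L(D + P)`. -/
def leadingCoeff {π : F} (hπ : P.val π = WithZero.exp (-(D P + 1))) :
    riemannRochSpace (D + Finsupp.single P 1) →ₗ[k] P.Residue where
  toFun x := IsLocalRing.residue P.ring ⟨π * x, mul_mem_ring_of_val_eq D P hπ x.2⟩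
  map_add' x y := by
    rw [← map_add]
    congr 1
    exact Subtype.val_injective (mul_add π _ _)
  map_smul' c x := by
    rw [RingHom.id_apply, Algebra.smul_def, IsScalarTower.algebraMap_apply k P.ring P.Residue]
    change _ = IsLocalRing.residue P.ring _ * _
    rw [← map_mul]
    congr 1
    apply Subtype.val_injective
    change π * (c • (x : F)) = algebraMap k F c * (π * x)
    rw [Algebra.smul_def]; ring

/-- Values are discrete: a vanishing leading coefficient lowers the pole bound at `P` by a full
step. -/
theorem coe_mem_of_mem_ker_leadingCoeff {π : F} (hπ : P.val π = WithZero.exp (-(D P + 1)))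
    {x : riemannRochSpace (D + Finsupp.single P 1)} (hx : x ∈ (leadingCoeff D P hπ).ker) :
    (x : F) ∈ riemannRochSpace D := by
  have hx' : P.val (π * x) < 1 := (P.residue_eq_zero_iff _).1 hx
  rw [mem_riemannRochSpace]
  intro P'
  by_cases h : P' = P
  · subst h
    by_cases h0 : (x : F) = 0
    · simp [h0]
    have hv := (P'.val.ne_zero_iff).2 h0
    rw [← WithZero.exp_log hv]
    rw [map_mul, hπ, ← WithZero.exp_log hv, ← WithZero.exp_add, ← WithZero.exp_zero,
      WithZero.exp_lt_exp] at hx'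
    rw [WithZero.exp_le_exp]
    simp at hx' ⊢
    omega
  · have := mem_riemannRochSpace.1 x.2 P'
    rwa [Finsupp.add_apply, Finsupp.single_eq_of_ne h, add_zero] at this

/-- Rank-nullity for the leading coefficient: its kernel embeds in `L(D)` and its range lies in the
residue field. -/
theorem finite_and_finrank_le_of_add_single [Module.Finite k P.Residue]
    [Module.Finite k (riemannRochSpace D)] :
    Module.Finite k (riemannRochSpace (D + Finsupp.single P 1)) ∧
      Module.finrank k (riemannRochSpace (D + Finsupp.single P 1)) ≤
        Module.finrank k (riemannRochSpace D) + P.degree := by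
  obtain ⟨ϖ, hϖ⟩ := P.exists_val_eq_exp_neg_one
  have hπ : P.val (ϖ ^ (D P + 1)) = WithZero.exp (-(D P + 1)) := by
    rw [map_zpow₀, hϖ, ← WithZero.exp_zsmul]; simp
  let φ := leadingCoeff D P hπ
  let ψ : φ.ker →ₗ[k] riemannRochSpace D :=
    ((riemannRochSpace _).subtype ∘ₗ φ.ker.subtype).codRestrict _
      fun x => coe_mem_of_mem_ker_leadingCoeff D P hπ x.2
  have hψ : Function.Injective ψ := fun x y hxy =>
    Subtype.val_injective (Subtype.val_injective
      (congrArg (fun a : riemannRochSpace D => (a : F)) hxy))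
  have h1 : Module.Finite k φ.ker := Module.Finite.of_injective ψ hψ
  have h2 : Module.Finite k (_ ⧸ φ.ker) := Module.Finite.equiv φ.quotKerEquivRange.symm
  have h3 : Module.Finite k (riemannRochSpace (D + Finsupp.single P 1)) :=
    Module.Finite.of_submodule_quotient φ.ker
  refine ⟨h3, ?_⟩
  rw [← φ.finrank_range_add_finrank_ker, add_comm]
  exact add_le_add (LinearMap.finrank_le_finrank_of_injective hψ) (Submodule.finrank_le _)

end Step

theorem finite_and_finrank_le_of_le [∀ P : Place k F, Module.Finite k P.Residue]
    (A E : Divisor k F) (hE : 0 ≤ E) [Module.Finite k (riemannRochSpace A)] :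
    Module.Finite k (riemannRochSpace (A + E)) ∧
      (Module.finrank k (riemannRochSpace (A + E)) : ℤ) ≤
        Module.finrank k (riemannRochSpace A) + E.degree := by
  classical
  have key : ∀ (s : Multiset (Place k F)),
      Module.Finite k (riemannRochSpace (A + (s.map fun P => Finsupp.single P (1 : ℤ)).sum)) ∧
      (Module.finrank k (riemannRochSpace
        (A + (s.map fun P => Finsupp.single P (1 : ℤ)).sum)) : ℤ) ≤
        Module.finrank k (riemannRochSpace A) +
          Divisor.degree (s.map fun P => Finsupp.single P (1 : ℤ)).sum := by
    intro s
    induction s using Multiset.induction with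
    | empty =>
      rw [Multiset.map_zero, Multiset.sum_zero, add_zero, Divisor.degree_zero, add_zero]
      exact ⟨inferInstance, le_rfl⟩
    | cons P s ih =>
      obtain ⟨hfin, hle⟩ := ih
      have h := finite_and_finrank_le_of_add_single
        (A + (s.map fun P => Finsupp.single P (1 : ℤ)).sum) P
      rw [Multiset.map_cons, Multiset.sum_cons,
        add_comm (Finsupp.single P (1 : ℤ)), ← add_assoc]
      refine ⟨h.1, ?_⟩
      have h2 : (Module.finrank k (riemannRochSpace (A +
          (s.map fun P => Finsupp.single P (1 : ℤ)).sum + Finsupp.single P 1)) : ℤ) ≤ _ :=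
        Int.ofNat_le.2 h.2
      refine h2.trans ?_
      rw [Divisor.degree_add, Divisor.degree_single]
      push_cast
      linarith
  -- An effective divisor is a multiset of places, so the one-place bound can be iterated.
  have hs : ∃ s : Multiset (Place k F), E = (s.map fun P => Finsupp.single P (1 : ℤ)).sum := by
    refine ⟨Finsupp.toMultiset (E.mapRange Int.toNat rfl), ?_⟩
    ext P
    have : ∀ s : Multiset (Place k F),
        (s.map fun P => Finsupp.single P (1 : ℤ)).sum P = s.count P := by
      intro s
      induction s using Multiset.induction with
      | empty => simp
      | cons a s ih =>
        rw [Multiset.map_cons, Multiset.sum_cons, Finsupp.add_apply, ih, Multiset.count_cons,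
          Finsupp.single_apply]
        split_ifs with h1 h2 h2
        · push_cast; ring
        · exact absurd h1.symm h2
        · exact absurd h2.symm h1
        · simp
    rw [this, Finsupp.count_toMultiset, Finsupp.mapRange_apply]
    exact (Int.toNat_of_nonneg (hE P)).symm
  obtain ⟨s, rfl⟩ := hs
  exact key s

end RiemannRochSpaces

/-! ### Consequences of a finite genus: finite dimension, degrees, zeros and poles -/

section Genus

variable {k F : Type*} [Field k] [Field F] [Algebra k F]

theorem IsGenus.degree_add_one_sub_le {g : ℤ} (hg : IsGenus k F g) (D : Divisor k F) :
    D.degree + 1 - g ≤ Module.finrank k (riemannRochSpace D) := by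
  have := hg.2 ⟨D, rfl⟩
  linarith

theorem Place.poleOrder_eq_zero_iff (P : Place k F) {x : F} : P.poleOrder x = 0 ↔ x ∈ P.ring := by
  rw [← P.val_le_one_iff, Place.poleOrder, Int.toNat_eq_zero]
  by_cases hx : x = 0
  · simp [hx]
  · rw [WithZero.log_le_iff_le_exp ((P.val.ne_zero_iff).2 hx), WithZero.exp_zero]

theorem Place.val_le_exp_poleOrder (P : Place k F) (x : F) :
    P.val x ≤ WithZero.exp (P.poleOrder x : ℤ) := by
  by_cases hx : x = 0
  · simp [hx]
  · rw [← WithZero.log_le_iff_le_exp ((P.val.ne_zero_iff).2 hx)]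
    exact Int.self_le_toNat _

theorem Place.poleOrder_le_iff (P : Place k F) {x : F} {n : ℕ} :
    P.poleOrder x ≤ n ↔ P.val x ≤ WithZero.exp (n : ℤ) := by
  by_cases hx : x = 0
  · simp [hx, Place.poleOrder]
  · rw [← WithZero.log_le_iff_le_exp ((P.val.ne_zero_iff).2 hx), Place.poleOrder, Int.toNat_le]

/-- The divisor of a function all of whose zeros and poles lie in a finite set. -/
def principalDivisor (w : F) (hw : {P : Place k F | P.val w ≠ 1}.Finite) : Divisor k F :=
  Finsupp.onFinset hw.toFinset (fun P => -WithZero.log (P.val w)) fun P hP => by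
    rw [Set.Finite.mem_toFinset, Set.mem_ofPred_eq]
    intro h
    simp [h] at hP

theorem val_eq_exp_principalDivisor {w : F} (hw0 : w ≠ 0)
    (hw : {P : Place k F | P.val w ≠ 1}.Finite) (P : Place k F) :
    P.val w = WithZero.exp (-principalDivisor w hw P) := by
  rw [principalDivisor, Finsupp.onFinset_apply, neg_neg,
    WithZero.exp_log ((P.val.ne_zero_iff).2 hw0)]

theorem Place.val_le_exp_neg_one_of_lt (P : Place k F) {x : F} (h : P.val x < 1) :
    P.val x ≤ WithZero.exp (-1) := by
  by_cases hx : x = 0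
  · simp [hx]
  · have hv := (P.val.ne_zero_iff).2 hx
    rw [← WithZero.exp_zero, ← WithZero.exp_log hv, WithZero.exp_lt_exp] at h
    rw [← WithZero.exp_log hv, WithZero.exp_le_exp]
    omega

theorem sum_single_apply (T : Finset (Place k F)) (P : Place k F) [Decidable (P ∈ T)] :
    (∑ P ∈ T, Finsupp.single P (1 : ℤ)) P = if P ∈ T then 1 else 0 := by
  classical
  simp [Finsupp.finsetSum_apply, Finsupp.single_apply]

theorem Divisor.degree_sum_single (T : Finset (Place k F)) :
    Divisor.degree (∑ P ∈ T, Finsupp.single P (1 : ℤ)) = ∑ P ∈ T, (P.degree : ℤ) := by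
  classical
  induction T using Finset.induction_on with
  | empty => simp [Divisor.degree_zero]
  | insert P T hP ih =>
    rw [Finset.sum_insert hP, Finset.sum_insert hP, Divisor.degree_add, ih,
      Divisor.degree_single, one_mul]

/-- The least common multiple of the pole divisors of a finite family. -/
def poleDivisor {ι : Type*} [Fintype ι] (x : ι → F)
    (hx : {P : Place k F | ∃ i, x i ∉ P.ring}.Finite) : Divisor k F :=
  Finsupp.onFinset hx.toFinset
    (fun P => ((Finset.univ.sup fun i => P.poleOrder (x i) : ℕ) : ℤ)) fun P hP => by
      rw [Set.Finite.mem_toFinset, Set.mem_ofPred_eq]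
      by_contra! h
      refine hP (Nat.cast_eq_zero.2 (Nat.le_zero.1 (Finset.sup_le fun i _ => ?_)))
      rw [(P.poleOrder_eq_zero_iff).2 (h i)]

theorem poleDivisor_apply {ι : Type*} [Fintype ι] (x : ι → F)
    (hx : {P : Place k F | ∃ i, x i ∉ P.ring}.Finite) (P : Place k F) :
    poleDivisor x hx P = ((Finset.univ.sup fun i => P.poleOrder (x i) : ℕ) : ℤ) := rfl

theorem polesDegree_eq_degree {ι : Type*} [Fintype ι] (x : ι → F)
    (hx : {P : Place k F | ∃ i, x i ∉ P.ring}.Finite) :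
    (polesDegree k x : ℤ) = (poleDivisor x hx).degree := by
  rw [polesDegree, finsum_eq_sum_of_support_subset (s := (poleDivisor x hx).support)]
  · push_cast
    rfl
  · intro P hP
    rw [Finset.mem_coe, Finsupp.mem_support_iff, poleDivisor_apply]
    intro h
    exact hP (by simp only [Nat.cast_eq_zero.1 h, zero_mul])

variable [Algebra (RatFunc k) F] [IsScalarTower k (RatFunc k) F] [FunctionField k F]

/-- `finrank` is `0` in infinite dimension. If `L(0)` were infinite-dimensional, so would be every
`L(nP)` with `n ≥ 0`, and `deg (nP) - 0 + 1` would exceed the maximum `g`. -/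
theorem IsGenus.finite_riemannRochSpace_zero {g : ℤ} (hg : IsGenus k F g) (P : Place k F) :
    Module.Finite k (riemannRochSpace (0 : Divisor k F)) := by
  by_contra hinf
  have h := hg.degree_add_one_sub_le (Finsupp.single P (g.toNat : ℤ))
  rw [Divisor.degree_single, Module.finrank_of_infinite_dimensional, Nat.cast_zero] at h
  · have h1 : (1 : ℤ) ≤ P.degree := by exact_mod_cast P.degree_pos
    have h2 := mul_le_mul_of_nonneg_left h1 (Int.natCast_nonneg g.toNat)
    have h3 := Int.self_le_toNat g
    linarith
  · intro hfin
    have hle : (0 : Divisor k F) ≤ Finsupp.single P (g.toNat : ℤ) := by simp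
    exact hinf (Submodule.finiteDimensional_of_le (riemannRochSpace_mono hle))

variable [Nonempty (Place k F)]

theorem IsGenus.finite_riemannRochSpace {g : ℤ} (hg : IsGenus k F g) (D : Divisor k F) :
    Module.Finite k (riemannRochSpace D) := by
  have := hg.finite_riemannRochSpace_zero (Classical.arbitrary _)
  have : ∀ P : Place k F, Module.Finite k P.Residue := fun P => P.finite_residue
  have h1 := (finite_and_finrank_le_of_le 0 (D ⊔ 0) le_sup_right).1
  rw [zero_add] at h1
  have h2 : D ≤ D ⊔ 0 := le_sup_left
  exact Submodule.finiteDimensional_of_le (riemannRochSpace_mono h2)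

/-- A function with poles bounded by `D` and zeros prescribed by `D` forces `deg D ≥ 0`. -/
theorem IsGenus.degree_nonneg_of_mem {g : ℤ} (hg : IsGenus k F g) {D : Divisor k F} {w : F}
    (hw : w ≠ 0) (hwD : w ∈ riemannRochSpace D) : 0 ≤ D.degree := by
  by_contra! hneg
  have := hg.finite_riemannRochSpace (0 : Divisor k F)
  -- Multiplication by `w ^ n` embeds `L(-nD)` in `L(0)`, while Riemann's inequality makes `ℓ(-nD)`
  -- grow linearly when `deg D < 0`.
  have h : ∀ n : ℕ, n * (-D.degree) + 1 - g ≤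
      Module.finrank k (riemannRochSpace (0 : Divisor k F)) := by
    intro n
    have h1 := hg.degree_add_one_sub_le ((-n : ℤ) • D)
    rw [Divisor.degree_smul] at h1
    have h2 : Module.finrank k (riemannRochSpace ((-n : ℤ) • D)) ≤
        Module.finrank k (riemannRochSpace (0 : Divisor k F)) := by
      refine finrank_riemannRochSpace_le_of_mul (pow_ne_zero n hw) fun P => ?_
      have h3 := pow_le_pow_left₀ zero_le (mem_riemannRochSpace.1 hwD P) n
      rw [← WithZero.exp_nsmul] at h3
      simpa using h3
    have h3 : (Module.finrank k (riemannRochSpace ((-n : ℤ) • D)) : ℤ) ≤ _ := Int.ofNat_le.2 h2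
    linarith
  have h1 := h (Module.finrank k (riemannRochSpace (0 : Divisor k F)) + g.toNat)
  have h3 := Int.self_le_toNat g
  push_cast at h1
  nlinarith

/-- Both `w` and its inverse lie in spaces `L(∓(w))`, so neither of the opposite divisors has
negative degree. -/
theorem IsGenus.degree_principalDivisor {g : ℤ} (hg : IsGenus k F g) {w : F} (hw0 : w ≠ 0)
    (hw : {P : Place k F | P.val w ≠ 1}.Finite) : (principalDivisor w hw).degree = 0 := by
  have h1 := hg.degree_nonneg_of_mem (inv_ne_zero hw0) (D := principalDivisor w hw)
    (mem_riemannRochSpace.2 fun P => by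
      rw [map_inv₀, val_eq_exp_principalDivisor hw0 hw, ← WithZero.exp_neg, neg_neg])
  have h2 := hg.degree_nonneg_of_mem hw0 (D := -principalDivisor w hw)
    (mem_riemannRochSpace.2 fun P => (val_eq_exp_principalDivisor hw0 hw P).le)
  rw [Divisor.degree_neg] at h2
  linarith

/-- Each zero outside the support of `D` may be subtracted from `D` and costs at least one degree;
too many would leave a negative degree. -/
theorem IsGenus.finite_setOf_val_lt_one {g : ℤ} (hg : IsGenus k F g) {w : F} (hw : w ≠ 0)
    {D : Divisor k F} (hwD : w ∈ riemannRochSpace D) : {P : Place k F | P.val w < 1}.Finite := by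
  classical
  suffices h : {P : Place k F | P.val w < 1 ∧ P ∉ D.support}.Finite by
    refine (h.union D.support.finite_toSet).subset fun P hP => ?_
    by_cases hPD : P ∈ D.support
    · exact Or.inr hPD
    · exact Or.inl ⟨hP, hPD⟩
  by_contra hinf
  obtain ⟨T, hT, hcard⟩ := Set.Infinite.exists_subset_card_eq hinf (D.degree.toNat + 1)
  have h1 := hg.degree_nonneg_of_mem hw (D := D - ∑ P ∈ T, Finsupp.single P (1 : ℤ))
    (mem_riemannRochSpace.2 fun P => by
      rw [Finsupp.sub_apply, sum_single_apply]
      split_ifs with hPT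
      · obtain ⟨h2, h3⟩ := hT hPT
        rw [Finsupp.notMem_support_iff.1 h3, zero_sub]
        exact P.val_le_exp_neg_one_of_lt h2
      · rw [sub_zero]
        exact mem_riemannRochSpace.1 hwD P)
  have h2 : (T.card : ℤ) ≤ ∑ P ∈ T, (P.degree : ℤ) := by
    rw [Finset.cast_card]
    exact Finset.sum_le_sum fun P _ => by exact_mod_cast P.degree_pos
  rw [Divisor.degree_sub, Divisor.degree_sum_single] at h1
  have h3 := Int.self_le_toNat D.degree
  rw [hcard] at h2
  push_cast at h2
  linarith

/-- If one transcendental function has only finitely many poles, then so has every function. -/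
theorem IsGenus.finite_poles {g : ℤ} (hg : IsGenus k F g) {z : F} (hz : Transcendental k z)
    (hfin : {P : Place k F | z ∉ P.ring}.Finite) (y : F) :
    {P : Place k F | y ∉ P.ring}.Finite := by
  obtain ⟨p, hp0, hp⟩ := Place.exists_polynomial_mem_ring hz y
  have hw : Polynomial.aeval z p ≠ 0 := fun h => hp0 (transcendental_iff.1 hz p h)
  have hwfin : {P : Place k F | ∃ _ : Unit, Polynomial.aeval z p ∉ P.ring}.Finite :=
    hfin.subset fun P hP hzP => hP.elim fun _ h => h (P.aeval_mem_ring hzP p)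
  have h1 := hg.finite_setOf_val_lt_one hw (D := poleDivisor (fun _ : Unit => _) hwfin)
    (mem_riemannRochSpace.2 fun P => by
      rw [poleDivisor_apply, Finset.univ_unique, Finset.sup_singleton]
      exact P.val_le_exp_poleOrder _)
  refine (hfin.union h1).subset fun P hP => ?_
  by_contra hcon
  rw [Set.mem_union, not_or] at hcon
  exact hP (hp P (not_not.1 hcon.1) (not_lt.1 hcon.2))

theorem IsGenus.finite_setOf_val_ne_one {g : ℤ} (hg : IsGenus k F g) {z : F}
    (hz : Transcendental k z) (hfin : {P : Place k F | z ∉ P.ring}.Finite) {y : F} (hy : y ≠ 0) :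
    {P : Place k F | P.val y ≠ 1}.Finite := by
  refine ((hg.finite_poles hz hfin y).union (hg.finite_poles hz hfin y⁻¹)).subset fun P hP => ?_
  rcases lt_or_gt_of_ne hP with h | h
  · right
    change ¬ _
    rw [← P.val_le_one_iff, map_inv₀, not_le]
    exact (one_lt_inv₀ (zero_lt_iff.2 ((P.val.ne_zero_iff).2 hy))).2 h
  · left
    change ¬ _
    rwa [← P.val_le_one_iff, not_le]

end Genus

/-! ### Convexity and the Clifford-type bound -/

theorem sub_le_of_convex {φ : ℤ → ℤ} (hφ : ∀ n, 2 * φ n ≤ φ (n + 1) + φ (n - 1))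
    (h : ∃ N : ℕ, φ N < φ 0 + 2 * N) (j : ℕ) : φ 0 - j ≤ φ (-j) := by
  -- A first increment of at least 2 would persist to the right and contradict the growth bound at
  -- `N`.
  have h1 : φ 1 - φ 0 ≤ 1 := by
    by_contra! hcon
    have hδ : ∀ n : ℕ, 2 ≤ φ (n + 1) - φ n := by
      intro n
      induction n with
      | zero =>
        simp
        omega
      | succ n ih =>
        have := hφ (n + 1)
        rw [add_sub_cancel_right] at this
        push_cast
        linarith
    obtain ⟨N, hN⟩ := h
    have : ∀ n : ℕ, φ 0 + 2 * n ≤ φ n := by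
      intro n
      induction n with
      | zero => simp
      | succ n ih =>
        have := hδ n
        push_cast
        linarith
    linarith [this N]
  -- Increments do not grow when moving left, so all those left of `0` are at most 1.
  have hδ : ∀ n : ℕ, φ (-n) - φ (-n - 1) ≤ 1 := by
    intro n
    induction n with
    | zero =>
      have := hφ 0
      simp at this ⊢
      linarith
    | succ n ih =>
      have := hφ (-n - 1)
      rw [sub_add_cancel] at this
      rw [show -((n + 1 : ℕ) : ℤ) = -n - 1 by push_cast; ring]
      linarith
  induction j with
  | zero => simp
  | succ j ih =>
    have := hδ j
    rw [show -((j + 1 : ℕ) : ℤ) = -j - 1 by push_cast; ring]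
    push_cast
    linarith

section Clifford

variable {k F : Type*} [Field k] [Field F] [Algebra k F]

theorem poleDivisor_unit_apply (z : F) (hz : {P : Place k F | ∃ _ : Unit, z ∉ P.ring}.Finite)
    (P : Place k F) : poleDivisor (fun _ : Unit => z) hz P = (P.poleOrder z : ℤ) := by
  rw [poleDivisor_apply, Finset.univ_unique, Finset.sup_singleton]

theorem mem_riemannRochSpace_poleDivisor (z : F)
    (hz : {P : Place k F | ∃ _ : Unit, z ∉ P.ring}.Finite) :
    z ∈ riemannRochSpace (poleDivisor (fun _ : Unit => z) hz) :=
  mem_riemannRochSpace.2 fun P => by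
    rw [poleDivisor_unit_apply]
    exact P.val_le_exp_poleOrder z

/-- At a pole of `z` the bound on `z * x` sharpens that on `x` by exactly the pole order; elsewhere
nothing is subtracted. -/
theorem mem_riemannRochSpace_sub_poleDivisor {z : F}
    (hz : {P : Place k F | ∃ _ : Unit, z ∉ P.ring}.Finite) {A : Divisor k F} {x : F}
    (hx : x ∈ riemannRochSpace A) (hzx : z * x ∈ riemannRochSpace A) :
    x ∈ riemannRochSpace (A - poleDivisor (fun _ : Unit => z) hz) := by
  rw [mem_riemannRochSpace] at *
  intro P
  rw [Finsupp.sub_apply, poleDivisor_unit_apply]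
  by_cases h : z ∈ P.ring
  · rw [P.poleOrder_eq_zero_iff.2 h, Nat.cast_zero, sub_zero]
    exact hx P
  · have h1 : P.val z ≠ 0 := by
      rw [P.val.ne_zero_iff]
      rintro rfl
      exact h P.ring.zero_mem
    have h2 : P.val z = WithZero.exp (P.poleOrder z : ℤ) := by
      rw [Place.poleOrder, Int.toNat_of_nonneg, WithZero.exp_log h1]
      by_contra! hcon
      exact h (P.poleOrder_eq_zero_iff.1 (Int.toNat_eq_zero.2 hcon.le))
    have h3 := hzx P
    rw [map_mul, h2] at h3
    rw [WithZero.exp_sub, le_div_iff₀ (zero_lt_iff.2 WithZero.exp_ne_zero), mul_comm]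
    exact h3

variable [Algebra (RatFunc k) F] [IsScalarTower k (RatFunc k) F] [FunctionField k F]
  [Nonempty (Place k F)]

/-- Convexity of `n ↦ ℓ(A + n (z)_∞)`. -/
theorem IsGenus.two_mul_finrank_le {g : ℤ} (hg : IsGenus k F g) {z : F} (hz0 : z ≠ 0)
    (hz : {P : Place k F | ∃ _ : Unit, z ∉ P.ring}.Finite) (A : Divisor k F) :
    2 * Module.finrank k (riemannRochSpace A) ≤
      Module.finrank k (riemannRochSpace (A + poleDivisor (fun _ : Unit => z) hz)) +
      Module.finrank k (riemannRochSpace (A - poleDivisor (fun _ : Unit => z) hz)) := by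
  set E := poleDivisor (fun _ : Unit => z) hz with hE
  have hfin := fun D : Divisor k F => hg.finite_riemannRochSpace D
  have hinj : Function.Injective (LinearMap.mulLeft k z) := fun x y h => mul_left_cancel₀ hz0 h
  let V := (riemannRochSpace A).map (LinearMap.mulLeft k z)
  have h1 : Module.finrank k V = Module.finrank k (riemannRochSpace A) :=
    (Submodule.equivMapOfInjective _ hinj _).finrank_eq.symm
  have h2 : Module.finrank k (V ⊓ riemannRochSpace A : Submodule k F) ≤
      Module.finrank k (riemannRochSpace (A - E)) := by
    rw [(Submodule.equivMapOfInjective _ hinj (riemannRochSpace (A - E))).finrank_eq]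
    refine Submodule.finrank_mono ?_
    rintro _ ⟨⟨x, hx, rfl⟩, hzx⟩
    exact ⟨x, mem_riemannRochSpace_sub_poleDivisor hz hx hzx, rfl⟩
  have h3 : Module.finrank k (V ⊔ riemannRochSpace A : Submodule k F) ≤
      Module.finrank k (riemannRochSpace (A + E)) := by
    refine Submodule.finrank_mono (sup_le ?_ (riemannRochSpace_mono ?_))
    · rintro _ ⟨x, hx, rfl⟩
      have hzE := mem_riemannRochSpace.1 (mem_riemannRochSpace_poleDivisor z hz)
      rw [SetLike.mem_coe, mem_riemannRochSpace] at hx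
      rw [mem_riemannRochSpace]
      intro P
      rw [LinearMap.mulLeft_apply, map_mul, mul_comm, Finsupp.add_apply, WithZero.exp_add]
      exact mul_le_mul' (hx P) (hzE P)
    · rw [le_add_iff_nonneg_right]
      intro P
      rw [hE, poleDivisor_apply]
      exact Int.natCast_nonneg _
  have h4 := Submodule.finrank_sup_add_finrank_inf_eq V (riemannRochSpace A)
  omega

/-- The Riemann inequality becomes an equality for large multiples of `E`. -/
theorem IsGenus.exists_finrank_le {g : ℤ} (hg : IsGenus k F g) {z : F}
    (hz : Transcendental k z) (hfin : {P : Place k F | z ∉ P.ring}.Finite)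
    (D E : Divisor k F) (hE : 0 < E.degree) :
    ∃ N : ℕ, (Module.finrank k (riemannRochSpace (D + (N : ℤ) • E)) : ℤ) ≤
      D.degree + N * E.degree + 1 - g := by
  have hfd := fun D : Divisor k F => hg.finite_riemannRochSpace D
  have hres : ∀ P : Place k F, Module.Finite k P.Residue := fun P => P.finite_residue
  obtain ⟨D₀, hD₀⟩ := hg.1
  -- `N` is large enough for Riemann's inequality to give `ℓ(A - D₀) ≥ 1`, where `D₀` attains the
  -- genus.
  let N := (g - D.degree + D₀.degree).toNat
  have hN : g - D.degree + D₀.degree ≤ N := Int.self_le_toNat _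
  refine ⟨N, ?_⟩
  set A := D + (N : ℤ) • E with hA
  have hdegA : A.degree = D.degree + N * E.degree := by
    rw [hA, Divisor.degree_add, Divisor.degree_smul]
  have h1 : 0 < Module.finrank k (riemannRochSpace (A - D₀)) := by
    have h := hg.degree_add_one_sub_le (A - D₀)
    rw [Divisor.degree_sub, hdegA] at h
    have : (N : ℤ) * 1 ≤ N * E.degree := mul_le_mul_of_nonneg_left hE (Int.natCast_nonneg N)
    have h0 : (0 : ℤ) < Module.finrank k (riemannRochSpace (A - D₀)) := by linarith
    exact_mod_cast h0
  obtain ⟨⟨w, hw⟩, hw0⟩ := Module.finrank_pos_iff_exists_ne_zero.1 h1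
  have hw0 : w ≠ 0 := fun h => hw0 (Subtype.val_injective h)
  have hwfin := hg.finite_setOf_val_ne_one hz hfin hw0
  let W := principalDivisor w hwfin
  have hW : W.degree = 0 := hg.degree_principalDivisor hw0 hwfin
  have h2 : Module.finrank k (riemannRochSpace A) ≤
      Module.finrank k (riemannRochSpace (A + W)) := by
    refine finrank_riemannRochSpace_le_of_mul (inv_ne_zero hw0) fun P => ?_
    rw [map_inv₀, val_eq_exp_principalDivisor hw0 hwfin, ← WithZero.exp_neg, neg_neg]
    simp [W]
  -- `A` is equivalent to a divisor above `D₀`. Growing from `D₀`, where Riemann's inequality is an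
  -- equality, costs at most the degree.
  have h3 : 0 ≤ A + W - D₀ := fun P => by
    have h := mem_riemannRochSpace.1 hw P
    rw [val_eq_exp_principalDivisor hw0 hwfin, WithZero.exp_le_exp, Finsupp.sub_apply] at h
    rw [Finsupp.sub_apply, Finsupp.add_apply, Finsupp.zero_apply]
    simp only [W]
    linarith
  have h4 := (finite_and_finrank_le_of_le D₀ _ h3).2
  rw [add_sub_cancel, Divisor.degree_sub, Divisor.degree_add, hW] at h4
  have h5 : (Module.finrank k (riemannRochSpace A) : ℤ) ≤ _ := Int.ofNat_le.2 h2
  linarith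

/-- In a function field of genus `g` with a function of degree two, a divisor `D` with
`ℓ(D) > g` has degree at least `2 g`. -/
theorem IsGenus.two_mul_le_degree {g : ℕ} (hg : IsGenus k F g) {z : F}
    (hz : Transcendental k z) (hfin : {P : Place k F | ∃ _ : Unit, z ∉ P.ring}.Finite)
    (hdeg : (poleDivisor (fun _ : Unit => z) hfin).degree = 2) {D : Divisor k F}
    (hD : g < Module.finrank k (riemannRochSpace D)) : 2 * (g : ℤ) ≤ D.degree := by
  by_contra! hcon
  set E := poleDivisor (fun _ : Unit => z) hfin with hE
  have hz0 : z ≠ 0 := by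
    rintro rfl
    exact hz isAlgebraic_zero
  have hfin' : {P : Place k F | z ∉ P.ring}.Finite := hfin.subset fun P hP => ⟨(), hP⟩
  have hfd := fun D : Divisor k F => hg.finite_riemannRochSpace D
  obtain ⟨N, hN⟩ := hg.exists_finrank_le hz hfin' D E (by rw [hdeg]; norm_num)
  have key := sub_le_of_convex
    (φ := fun n => (Module.finrank k (riemannRochSpace (D + n • E)) : ℤ)) (fun n => by
      have h := hg.two_mul_finrank_le hz0 hfin (D + n • E)
      rw [← hE] at h
      have e1 : D + (n + 1) • E = D + n • E + E := by rw [add_smul, one_smul, add_assoc]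
      have e2 : D + (n - 1) • E = D + n • E - E := by rw [sub_smul, one_smul, add_sub_assoc]
      rw [e1, e2]
      exact_mod_cast h)
    ⟨N, by
      rw [zero_smul, add_zero]
      rw [hdeg] at hN
      have : ((g : ℤ) + 1) ≤ Module.finrank k (riemannRochSpace D) := by exact_mod_cast hD
      linarith⟩ g
  beta_reduce at key
  rw [zero_smul, add_zero] at key
  -- Going `g` steps left loses at most `g` dimensions, and `ℓ(D) > g`.
  have hpos : 0 < Module.finrank k (riemannRochSpace (D + (-(g : ℤ)) • E)) := by
    zify at hD ⊢
    linarith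
  obtain ⟨⟨w, hw⟩, hw0⟩ := Module.finrank_pos_iff_exists_ne_zero.1 hpos
  have h := hg.degree_nonneg_of_mem (fun h => hw0 (Subtype.val_injective h)) hw
  rw [Divisor.degree_add, Divisor.degree_smul, hdeg] at h
  linarith

end Clifford

/-! ### Lower bound for the threshold of every Matdot code -/

section Optimality

variable {k F : Type*} [Field k] [Field F] [Algebra k F]

theorem Place.ord_eq_coe_iff (P : Place k F) {x : F} {n : ℤ} :
    P.ord x = (n : WithTop ℤ) ↔ P.val x = WithZero.exp (-n) := by
  unfold Place.ord
  split_ifs with hx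
  · simp [hx, WithZero.exp_ne_zero.symm]
  · rw [WithTop.coe_inj, ← WithZero.exp_log ((P.val.ne_zero_iff).2 hx), WithZero.exp_inj,
      WithZero.log_exp]
    omega

/-- Nonzero constants have value 1, so in a nontrivial combination a single term of largest value
dominates and the sum is nonzero. -/
theorem Place.linearIndependent_of_injective_val (P : Place k F) {ι : Type*} {f : ι → F}
    (h0 : ∀ i, f i ≠ 0) (hf : Function.Injective fun i => P.val (f i)) :
    LinearIndependent k f := by
  classical
  rw [linearIndependent_iff']
  intro s c hc
  by_contra! hne
  have hne' : (s.filter fun i => c i ≠ 0).Nonempty := by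
    obtain ⟨i, hi, hci⟩ := hne
    exact ⟨i, Finset.mem_filter.2 ⟨hi, hci⟩⟩
  obtain ⟨j, hj, hmax⟩ := Finset.exists_max_image _ (fun i => P.val (f i)) hne'
  obtain ⟨hjs, hcj⟩ := Finset.mem_filter.1 hj
  have hval : ∀ i, c i ≠ 0 → P.val (c i • f i) = P.val (f i) := fun i hi => by
    rw [Algebra.smul_def, map_mul, P.val_algebraMap hi, one_mul]
  have h1 := P.val.map_sum_eq_of_lt (f := fun i => c i • f i) hjs fun i hi => by
    obtain ⟨his, hij⟩ := Finset.mem_sdiff.1 hi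
    rw [Finset.mem_singleton] at hij
    rw [hval j hcj]
    by_cases hci : c i = 0
    · rw [hci, zero_smul, map_zero]
      exact zero_lt_iff.2 ((P.val.ne_zero_iff).2 (h0 j))
    · rw [hval i hci]
      exact lt_of_le_of_ne (hmax i (Finset.mem_filter.2 ⟨his, hci⟩)) (hf.ne hij)
  rw [hc, map_zero, hval j hcj] at h1
  exact (P.val.ne_zero_iff).2 (h0 j) h1.symm

/-- The least divisor whose Riemann-Roch space contains all members of the family `f`. -/
def hullDivisor {ι : Type*} [Fintype ι] [Nonempty ι] (f : ι → F)
    (hf : {P : Place k F | ∃ i, P.val (f i) ≠ 1}.Finite) : Divisor k F :=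
  Finsupp.onFinset hf.toFinset
    (fun P => Finset.univ.sup' Finset.univ_nonempty fun i => WithZero.log (P.val (f i)))
    fun P hP => by
      rw [Set.Finite.mem_toFinset, Set.mem_ofPred_eq]
      by_contra! h
      exact hP (by simp [h])

section

variable {ι : Type*} [Fintype ι] [Nonempty ι] {f : ι → F}
  (hf : {P : Place k F | ∃ i, P.val (f i) ≠ 1}.Finite)

theorem log_val_le_hullDivisor (P : Place k F) (i : ι) :
    WithZero.log (P.val (f i)) ≤ hullDivisor f hf P :=
  Finset.le_sup' (fun i => WithZero.log (P.val (f i))) (Finset.mem_univ i)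

theorem exists_hullDivisor_eq (P : Place k F) :
    ∃ i, hullDivisor f hf P = WithZero.log (P.val (f i)) := by
  obtain ⟨i, -, hi⟩ := Finset.exists_mem_eq_sup' Finset.univ_nonempty
    fun i => WithZero.log (P.val (f i))
  exact ⟨i, hi⟩

theorem mem_riemannRochSpace_hullDivisor (h0 : ∀ i, f i ≠ 0) (i : ι) :
    f i ∈ riemannRochSpace (hullDivisor f hf) :=
  mem_riemannRochSpace.2 fun P => by
    rw [← WithZero.log_le_iff_le_exp ((P.val.ne_zero_iff).2 (h0 i))]
    exact log_val_le_hullDivisor hf P i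

theorem card_le_finrank_hullDivisor (h0 : ∀ i, f i ≠ 0) (Q : Place k F)
    (hQ : Function.Injective fun i => Q.val (f i))
    [Module.Finite k (riemannRochSpace (hullDivisor f hf))] :
    Fintype.card ι ≤ Module.finrank k (riemannRochSpace (hullDivisor f hf)) := by
  have h : LinearIndependent k fun i =>
      (⟨f i, mem_riemannRochSpace_hullDivisor hf h0 i⟩ : riemannRochSpace (hullDivisor f hf)) :=
    LinearIndependent.of_comp (riemannRochSpace (hullDivisor f hf)).subtype
      (Q.linearIndependent_of_injective_val h0 hQ)
  exact h.fintype_card_le_finrank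

/-- At each place the two maxima are attained at some `i` and `j` independently, and all products `f
i * g j` belong to the family. -/
theorem hullDivisor_add_le {κ : Type*} [Fintype κ] [Nonempty κ] {g : κ → F}
    (hg : {P : Place k F | ∃ i, P.val (g i) ≠ 1}.Finite) (hf0 : ∀ i, f i ≠ 0)
    (hg0 : ∀ i, g i ≠ 0)
    (hfg : {P : Place k F | ∃ p : ι × κ, f p.1 * g p.2 ∉ P.ring}.Finite) :
    hullDivisor f hf + hullDivisor g hg ≤
      poleDivisor (fun p : ι × κ => f p.1 * g p.2) hfg := fun P => by
  obtain ⟨i, hi⟩ := exists_hullDivisor_eq hf P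
  obtain ⟨j, hj⟩ := exists_hullDivisor_eq hg P
  have h3 : WithZero.log (P.val (f i * g j)) =
      WithZero.log (P.val (f i)) + WithZero.log (P.val (g j)) := by
    rw [map_mul, WithZero.log_mul ((P.val.ne_zero_iff).2 (hf0 i)) ((P.val.ne_zero_iff).2 (hg0 j))]
  rw [Finsupp.add_apply, hi, hj, poleDivisor_apply, ← h3]
  have h1 : ∀ φ : ι × κ → ℕ, φ (i, j) ≤ Finset.univ.sup φ := fun φ =>
    Finset.le_sup (Finset.mem_univ (i, j))
  have h2 : WithZero.log (P.val (f i * g j)) ≤ (P.poleOrder (f i * g j) : ℤ) :=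
    Int.self_le_toNat _
  exact h2.trans (Nat.cast_le.2 (h1 fun p => P.poleOrder (f p.1 * g p.2)))

end

/-- If `f i` and `f j` had equal value at `Q`, then `f i * g j` would have the diagonal value of `f
j * g j`, forcing `i = j`. -/
theorem IsMatdotCode.ne_zero_and_injective {m : ℕ} {Q : Place k F} {f g : Fin m → F}
    (h : IsMatdotCode Q f g) :
    ((∀ i, f i ≠ 0) ∧ Function.Injective fun i => Q.val (f i)) ∧
      (∀ i, g i ≠ 0) ∧ Function.Injective fun i => Q.val (g i) := by
  obtain ⟨d, hd⟩ := h
  simp only [Place.ord_eq_coe_iff, map_mul] at hd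
  have h0 : ∀ i, f i ≠ 0 ∧ g i ≠ 0 := fun i => by
    have h := (hd i i).2 rfl
    rw [← not_or]
    rintro (h1 | h1) <;> rw [h1, map_zero] at h
    · rw [zero_mul] at h
      exact WithZero.exp_ne_zero h.symm
    · rw [mul_zero] at h
      exact WithZero.exp_ne_zero h.symm
  refine ⟨⟨fun i => (h0 i).1, fun i j hij => (hd i j).1 ?_⟩,
    fun i => (h0 i).2, fun i j hij => (hd i j).1 ?_⟩
  · rw [← (hd j j).2 rfl]
    exact congrArg (· * _) hij
  · rw [← (hd i i).2 rfl]
    exact congrArg (_ * ·) hij.symm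

theorem IsFriendly.transcendental {m : ℕ} {Q : Place k F} {z : F} (h : IsFriendly m Q z) :
    Transcendental k z := by
  have h1 := Q.ord_eq_coe_iff.1 h.ord_eq
  refine Q.transcendental_of_val_lt_one ?_ ?_
  · rintro rfl
    rw [map_zero] at h1
    exact WithZero.exp_ne_zero h1.symm
  · rw [h1, ← WithZero.exp_zero, WithZero.exp_lt_exp]
    norm_num

variable [Algebra (RatFunc k) F] [IsScalarTower k (RatFunc k) F] [FunctionField k F]

/-- A `finsum` with infinite support is `0` by default, so a nonzero pole degree certifies finitely
many poles; positivity of place degrees keeps every pole in the support. -/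
theorem finite_poles_of_polesDegree_ne_zero {ι : Type*} [Fintype ι] {x : ι → F}
    (hx : polesDegree k x ≠ 0) : {P : Place k F | ∃ i, x i ∉ P.ring}.Finite := by
  have h : (Function.support fun P : Place k F =>
      (Finset.univ.sup fun i => P.poleOrder (x i)) * P.degree).Finite := by
    by_contra hinf
    exact hx (finsum_of_infinite_support hinf)
  refine h.subset ?_
  rintro P ⟨i, hi⟩
  refine mul_ne_zero (fun h0 => hi ?_) P.degree_pos.ne'
  rw [← P.poleOrder_eq_zero_iff, ← Nat.le_zero, ← h0]
  exact Finset.le_sup (f := fun i => P.poleOrder (x i)) (Finset.mem_univ i)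

theorem IsFriendly.le_polesDegree_of_isMatdotCode {m : ℕ} (hm : 1 ≤ m) {Q : Place k F} {z : F}
    (hF : IsFriendly m Q z) {Q' : Place k F} {f g : Fin m → F} (h : IsMatdotCode Q' f g) :
    4 * (m : ℤ) - 4 ≤ polesDegree k fun p : Fin m × Fin m => f p.1 * g p.2 := by
  obtain ⟨⟨hf0, hf⟩, hg0, hg⟩ := h.ne_zero_and_injective
  have : Nonempty (Place k F) := ⟨Q⟩
  have : Nonempty (Fin m) := ⟨⟨0, hm⟩⟩
  have hgen : IsGenus k F ((m - 1 : ℕ) : ℤ) := by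
    rw [Nat.cast_sub hm, Nat.cast_one]; exact hF.genus
  have hz := hF.transcendental
  have hzfin := finite_poles_of_polesDegree_ne_zero (k := k) (x := fun _ : Unit => z)
    (by rw [hF.poles]; norm_num)
  have hzfin' : {P : Place k F | z ∉ P.ring}.Finite := hzfin.subset fun P hP => ⟨(), hP⟩
  have hdeg : (poleDivisor (fun _ : Unit => z) hzfin).degree = 2 := by
    rw [← polesDegree_eq_degree, hF.poles]; rfl
  have hfd := fun D : Divisor k F => hgen.finite_riemannRochSpace D
  have hfin : ∀ f : Fin m → F, (∀ i, f i ≠ 0) →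
      {P : Place k F | ∃ i, P.val (f i) ≠ 1}.Finite := fun f hf => by
    rw [Set.ofPred_exists]
    exact Set.finite_iUnion fun i => hgen.finite_setOf_val_ne_one hz hzfin' (hf i)
  have hfg : {P : Place k F | ∃ p : Fin m × Fin m, f p.1 * g p.2 ∉ P.ring}.Finite := by
    rw [Set.ofPred_exists]
    exact Set.finite_iUnion fun i => hgen.finite_poles hz hzfin' _
  have h1 : ∀ (f : Fin m → F) (hf0 : ∀ i, f i ≠ 0),
      (Function.Injective fun i => Q'.val (f i)) →
      2 * ((m - 1 : ℕ) : ℤ) ≤ (hullDivisor f (hfin f hf0)).degree := fun f hf0 hf => by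
    refine hgen.two_mul_le_degree hz hzfin hdeg ?_
    have h2 := card_le_finrank_hullDivisor (hfin f hf0) hf0 Q' hf
    rw [Fintype.card_fin] at h2
    omega
  have h2 := Divisor.degree_mono (hullDivisor_add_le (hfin f hf0) (hfin g hg0) hf0 hg0 hfg)
  rw [Divisor.degree_add, ← polesDegree_eq_degree] at h2
  have h3 := h1 f hf0 hf
  have h4 := h1 g hg0 hg
  omega

end Optimality

/-! ### Pole divisors of polynomials in `z` -/

section PolesOfPolynomials

variable {k F : Type*} [Field k] [Field F] [Algebra k F]

theorem Place.poleOrder_pow (P : Place k F) (z : F) (n : ℕ) :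
    P.poleOrder (z ^ n) = n * P.poleOrder z := by
  simp only [Place.poleOrder, map_pow, WithZero.log_pow, nsmul_eq_mul]
  rcases le_total 0 (WithZero.log (P.val z)) with h | h
  · rw [Int.toNat_mul (Int.natCast_nonneg n) h, Int.toNat_natCast]
  · rw [Int.toNat_of_nonpos h, mul_zero,
      Int.toNat_of_nonpos (mul_nonpos_of_nonneg_of_nonpos (Int.natCast_nonneg n) h)]

theorem Place.poleOrder_sum_le (P : Place k F) (z : F) {N n : ℕ} (hN : N ≤ n + 1)
    (c : Fin N → k) :
    P.poleOrder (∑ l : Fin N, z ^ (l : ℕ) * algebraMap k F (c l)) ≤ n * P.poleOrder z := by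
  rw [P.poleOrder_le_iff]
  refine P.val.map_sum_le fun l _ => ?_
  rw [map_mul]
  refine (mul_le_of_le_one_right' (P.val_algebraMap_le_one _)).trans
    ((P.val_le_exp_poleOrder _).trans ?_)
  rw [WithZero.exp_le_exp, Nat.cast_le, P.poleOrder_pow]
  exact Nat.mul_le_mul_right _ (by omega)

/-- At a pole of `z` the top term strictly dominates; away from the poles both sides are zero. -/
theorem Place.poleOrder_sum_eq (P : Place k F) (z : F) {N : ℕ} (c : Fin N → k) (j : Fin N)
    (hj : (j : ℕ) + 1 = N) (hc : c j ≠ 0) :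
    P.poleOrder (∑ l : Fin N, z ^ (l : ℕ) * algebraMap k F (c l)) = j * P.poleOrder z := by
  by_cases hz : z ∈ P.ring
  · refine le_antisymm (P.poleOrder_sum_le z hj.ge c) ?_
    rw [P.poleOrder_eq_zero_iff.2 hz, mul_zero]
    exact Nat.zero_le _
  · have hz1 : 1 < P.val z := by rwa [← not_le, P.val_le_one_iff]
    have hj' : P.val (z ^ (j : ℕ) * algebraMap k F (c j)) = P.val z ^ (j : ℕ) := by
      rw [map_mul, map_pow, P.val_algebraMap hc, mul_one]
    have h := P.val.map_sum_eq_of_lt (f := fun l : Fin N => z ^ (l : ℕ) * algebraMap k F (c l))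
      (Finset.mem_univ j) fun i hi => by
        have hij : i ≠ j := by simpa using hi
        rw [hj', map_mul, map_pow]
        refine lt_of_le_of_lt (mul_le_of_le_one_right' (P.val_algebraMap_le_one _)) ?_
        refine pow_lt_pow_right₀ hz1 ?_
        have := Fin.val_ne_of_ne hij
        omega
    rw [← P.poleOrder_pow, Place.poleOrder, h, hj', ← map_pow]
    rfl

variable [Algebra (RatFunc k) F] [IsScalarTower k (RatFunc k) F] [FunctionField k F]

theorem polesDegree_le_mul {z : F} (hz : polesDegree k (fun _ : Unit => z) ≠ 0) {ι : Type*}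
    [Fintype ι] {x : ι → F} {n : ℕ}
    (h : ∀ (P : Place k F) i, P.poleOrder (x i) ≤ n * P.poleOrder z) :
    {P : Place k F | ∃ i, x i ∉ P.ring}.Finite ∧
      polesDegree k x ≤ n * polesDegree k fun _ : Unit => z := by
  have hzfin := finite_poles_of_polesDegree_ne_zero hz
  have hx : {P : Place k F | ∃ i, x i ∉ P.ring}.Finite := by
    refine hzfin.subset ?_
    rintro P ⟨i, hi⟩
    refine ⟨(), fun hzP => hi ?_⟩
    have h1 := h P i
    rw [P.poleOrder_eq_zero_iff.2 hzP, mul_zero] at h1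
    exact P.poleOrder_eq_zero_iff.1 (Nat.le_zero.1 h1)
  refine ⟨hx, ?_⟩
  have h1 : poleDivisor x hx ≤ (n : ℤ) • poleDivisor (fun _ : Unit => z) hzfin := fun P => by
    rw [Finsupp.smul_apply, poleDivisor_unit_apply, poleDivisor_apply, smul_eq_mul,
      ← Nat.cast_mul, Nat.cast_le]
    exact Finset.sup_le fun i _ => h P i
  have h2 := Divisor.degree_mono h1
  rw [Divisor.degree_smul, ← polesDegree_eq_degree, ← polesDegree_eq_degree] at h2
  exact_mod_cast h2

theorem polesDegree_eq_mul {z : F} (hz : polesDegree k (fun _ : Unit => z) ≠ 0) {ι : Type*}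
    [Fintype ι] {x : ι → F} {n : ℕ}
    (h : ∀ (P : Place k F) i, P.poleOrder (x i) ≤ n * P.poleOrder z) {i : ι}
    (hi : ∀ P : Place k F, P.poleOrder (x i) = n * P.poleOrder z) :
    polesDegree k x = n * polesDegree k fun _ : Unit => z := by
  obtain ⟨hx, hle⟩ := polesDegree_le_mul hz h
  refine le_antisymm hle ?_
  have hzfin := finite_poles_of_polesDegree_ne_zero hz
  have h1 : (n : ℤ) • poleDivisor (fun _ : Unit => z) hzfin ≤ poleDivisor x hx := fun P => by
    rw [Finsupp.smul_apply, poleDivisor_unit_apply, poleDivisor_apply, smul_eq_mul,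
      ← Nat.cast_mul, Nat.cast_le, ← hi P]
    exact Finset.le_sup (f := fun i => P.poleOrder (x i)) (Finset.mem_univ i)
  have h2 := Divisor.degree_mono h1
  rw [Divisor.degree_smul, ← polesDegree_eq_degree, ← polesDegree_eq_degree] at h2
  exact_mod_cast h2

end PolesOfPolynomials

/-! ### The code as polynomial multiplication, and its evaluation -/

section Matrices

variable {k F : Type*} [Field k] [Field F] [Algebra k F] {m n r t : ℕ}

/-- The exponent of `z` in the product of the `i`-th and the `j`-th function of the code. -/
def expIndex (i j : Fin m) : Fin (2 * m - 1) := ⟨i + (m - 1 - j), by omega⟩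

/-- The coefficient matrix of `z ^ l` in `h`. -/
def prodCoeff (A : Matrix (Fin r) (Fin (m * n)) k) (B : Matrix (Fin (m * n)) (Fin t) k)
    (l : Fin (2 * m - 1)) : Matrix (Fin r) (Fin t) k :=
  ∑ i : Fin m, ∑ j : Fin m, if expIndex i j = l then blockCol A i * blockRow B j else 0

theorem encodeProd_eq_sum {f g : Fin m → F} {z : F} (hf : ∀ i, f i = z ^ (i : ℕ))
    (hg : ∀ j, g j = z ^ (m - 1 - (j : ℕ)))
    (A : Matrix (Fin r) (Fin (m * n)) k) (B : Matrix (Fin (m * n)) (Fin t) k) :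
    encodeProd f g A B =
      ∑ l : Fin (2 * m - 1), z ^ (l : ℕ) • (prodCoeff A B l).map (algebraMap k F) := by
  have h1 : ∀ l, (prodCoeff A B l).map (algebraMap k F) = ∑ i : Fin m, ∑ j : Fin m,
      if expIndex i j = l then
        (blockCol A i).map (algebraMap k F) * (blockRow B j).map (algebraMap k F) else 0 := by
    intro l
    have h2 : ∀ M : Matrix (Fin r) (Fin t) k,
        M.map (algebraMap k F) = (algebraMap k F).toAddMonoidHom.mapMatrix M := fun _ => rfl
    rw [h2, prodCoeff, map_sum]
    refine Finset.sum_congr rfl fun i _ => ?_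
    rw [map_sum]
    refine Finset.sum_congr rfl fun j _ => ?_
    split_ifs
    · rw [← h2, Matrix.map_mul]
    · exact map_zero _
  simp_rw [h1, Finset.smul_sum]
  rw [Finset.sum_comm, encodeProd, encodeLeft, encodeRight, Matrix.sum_mul]
  refine Finset.sum_congr rfl fun i _ => ?_
  rw [Finset.sum_comm, Matrix.mul_sum]
  refine Finset.sum_congr rfl fun j _ => ?_
  simp_rw [smul_ite, smul_zero]
  rw [Finset.sum_ite_eq, if_pos (Finset.mem_univ _), Matrix.smul_mul, Matrix.mul_smul, smul_smul,
    hf, hg, ← pow_add]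
  rfl

theorem encodeProd_apply_eq_sum {f g : Fin m → F} {z : F} (hf : ∀ i, f i = z ^ (i : ℕ))
    (hg : ∀ j, g j = z ^ (m - 1 - (j : ℕ)))
    (A : Matrix (Fin r) (Fin (m * n)) k) (B : Matrix (Fin (m * n)) (Fin t) k) (a : Fin r)
    (b : Fin t) :
    encodeProd f g A B a b =
      ∑ l : Fin (2 * m - 1), z ^ (l : ℕ) * algebraMap k F (prodCoeff A B l a b) := by
  rw [encodeProd_eq_sum hf hg, Matrix.sum_apply]
  rfl

theorem prodCoeff_diagonal (h : m - 1 < 2 * m - 1) (A : Matrix (Fin r) (Fin (m * n)) k)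
    (B : Matrix (Fin (m * n)) (Fin t) k) :
    prodCoeff A B ⟨m - 1, h⟩ = A * B := by
  have h1 : ∀ i j : Fin m, expIndex i j = ⟨m - 1, h⟩ ↔ i = j := fun i j => by
    rw [expIndex, Fin.mk.injEq, Fin.ext_iff]
    omega
  simp only [prodCoeff, h1, Finset.sum_ite_eq, Finset.mem_univ, if_true]
  ext a b
  rw [Matrix.sum_apply, Matrix.mul_apply, ← finProdFinEquiv.sum_comp, Fintype.sum_prod_type]
  rfl

/-- The largest exponent arises only from the last block of `A` and the first block of `B`. -/
theorem prodCoeff_last (h : 2 * m - 2 < 2 * m - 1) (h₁ : m - 1 < m) (h₀ : 0 < m)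
    (A : Matrix (Fin r) (Fin (m * n)) k) (B : Matrix (Fin (m * n)) (Fin t) k) :
    prodCoeff A B ⟨2 * m - 2, h⟩ = blockCol A ⟨m - 1, h₁⟩ * blockRow B ⟨0, h₀⟩ := by
  have h1 : ∀ i j : Fin m, expIndex i j = ⟨2 * m - 2, h⟩ ↔
      (⟨m - 1, h₁⟩ : Fin m) = i ∧ (⟨0, h₀⟩ : Fin m) = j := fun i j => by
    rw [expIndex, Fin.mk.injEq, Fin.ext_iff, Fin.ext_iff]
    simp only
    omega
  simp only [prodCoeff, h1, ite_and, Finset.sum_ite_eq, Finset.mem_univ, if_true,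
    Finset.sum_ite_irrel, Finset.sum_const_zero]

theorem eq_of_sum_pow_smul_map_eq {z : F} (hz : Transcendental k z) {N : ℕ}
    {C C' : Fin N → Matrix (Fin r) (Fin t) k}
    (h : ∑ l : Fin N, z ^ (l : ℕ) • (C l).map (algebraMap k F) =
      ∑ l : Fin N, z ^ (l : ℕ) • (C' l).map (algebraMap k F)) : C = C' := by
  ext l a b
  have h1 := congrFun (congrFun h a) b
  rw [Matrix.sum_apply, Matrix.sum_apply] at h1
  have key : ∀ C : Fin N → Matrix (Fin r) (Fin t) k,
      ∑ l : Fin N, (z ^ (l : ℕ) • (C l).map (algebraMap k F)) a b =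
      Polynomial.aeval z (∑ l : Fin N, Polynomial.monomial (l : ℕ) (C l a b)) := fun C => by
    rw [map_sum]
    refine Finset.sum_congr rfl fun l _ => ?_
    rw [Polynomial.aeval_monomial, mul_comm]
    rfl
  rw [key, key] at h1
  have h2 := congrArg (fun p => p.coeff (l : ℕ)) (transcendental_iff_injective.1 hz h1)
  simpa [Polynomial.finsetSum_coeff, Polynomial.coeff_monomial, ← Fin.ext_iff] using h2

section Evaluation

variable (P : Place k F)

theorem Place.eval_coe (x : P.ring) : P.eval (x : F) = IsLocalRing.residue P.ring x := by
  rw [Place.eval, dif_pos x.2]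

theorem Place.eval_sub {x y : F} (hx : x ∈ P.ring) (hy : y ∈ P.ring) :
    P.eval (x - y) = P.eval x - P.eval y := by
  lift x to P.ring using hx
  lift y to P.ring using hy
  rw [P.eval_coe, P.eval_coe, ← map_sub, ← P.eval_coe]
  rfl

theorem Place.eval_eq_zero_iff {x : F} (hx : x ∈ P.ring) : P.eval x = 0 ↔ P.val x < 1 := by
  lift x to P.ring using hx
  rw [P.eval_coe, P.residue_eq_zero_iff]

theorem Place.eval_aeval {x : F} (hx : x ∈ P.ring) (p : Polynomial k) :
    P.eval (Polynomial.aeval x p) = Polynomial.aeval (P.eval x) p := by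
  lift x to P.ring using hx
  rw [← P.coe_aeval, P.eval_coe, P.eval_coe]
  exact (Polynomial.aeval_algebraMap_apply P.Residue x p).symm

theorem Place.map_eval_mul {ι κ μ : Type*} [Fintype κ] {M : Matrix ι κ F} {N : Matrix κ μ F}
    (hM : ∀ a b, M a b ∈ P.ring) (hN : ∀ a b, N a b ∈ P.ring) :
    M.map P.eval * N.map P.eval = (M * N).map P.eval := by
  let M' : Matrix ι κ P.ring := fun a b => ⟨M a b, hM a b⟩
  let N' : Matrix κ μ P.ring := fun a b => ⟨N a b, hN a b⟩
  have h1 : M.map P.eval = M'.map (IsLocalRing.residue P.ring) := by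
    ext a b; exact P.eval_coe (M' a b)
  have h2 : N.map P.eval = N'.map (IsLocalRing.residue P.ring) := by
    ext a b; exact P.eval_coe (N' a b)
  have h3 : M * N = (M' * N').map P.ring.subtype := by
    rw [Matrix.map_mul]; rfl
  rw [h1, h2, ← Matrix.map_mul, h3]
  ext a b
  exact (P.eval_coe ((M' * N') a b)).symm

theorem encodeLeft_apply (f : Fin m → F) (A : Matrix (Fin r) (Fin (m * n)) k) (a : Fin r)
    (b : Fin n) :
    encodeLeft f A a b = ∑ i, f i * algebraMap k F (A a (finProdFinEquiv (i, b))) := by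
  rw [encodeLeft, Matrix.sum_apply]; rfl

theorem encodeRight_apply (g : Fin m → F) (B : Matrix (Fin (m * n)) (Fin t) k) (a : Fin n)
    (b : Fin t) :
    encodeRight g B a b = ∑ i, g i * algebraMap k F (B (finProdFinEquiv (i, a)) b) := by
  rw [encodeRight, Matrix.sum_apply]; rfl

theorem encodeProd_apply (f g : Fin m → F) (A : Matrix (Fin r) (Fin (m * n)) k)
    (B : Matrix (Fin (m * n)) (Fin t) k) (a : Fin r) (b : Fin t) :
    encodeProd f g A B a b = ∑ c, encodeLeft f A a c * encodeRight g B c b :=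
  Matrix.mul_apply

theorem response_eq_map_eval {f g : Fin m → F} (hf : ∀ i, f i ∈ P.ring) (hg : ∀ i, g i ∈ P.ring)
    (A : Matrix (Fin r) (Fin (m * n)) k) (B : Matrix (Fin (m * n)) (Fin t) k) :
    response f g P A B = (encodeProd f g A B).map P.eval := by
  refine P.map_eval_mul (fun a b => ?_) fun a b => ?_
  · rw [encodeLeft_apply]
    exact sum_mem fun i _ => mul_mem (hf i) (P.algebraMap_mem _)
  · rw [encodeRight_apply]
    exact sum_mem fun i _ => mul_mem (hg i) (P.algebraMap_mem _)

end Evaluation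

/-- Two polynomials of degree less than `m` as a pair of messages: the function `h` has all its
entries equal to the value of their product at `z`. -/
theorem exists_encodeProd_eq_aeval_mul {f g : Fin m → F} {z : F} (hf : ∀ i, f i = z ^ (i : ℕ))
    (hg : ∀ j, g j = z ^ (m - 1 - (j : ℕ))) (hn : 1 ≤ n) {p q : Polynomial k}
    (hp : p.natDegree < m) (hq : q.natDegree < m) :
    ∃ (A : Matrix (Fin r) (Fin (m * n)) k) (B : Matrix (Fin (m * n)) (Fin t) k),
      ∀ a b, encodeProd f g A B a b = Polynomial.aeval z (p * q) := by
  -- Only the first inner index of each block is used, so the matrix product has a single term. The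
  -- coefficients of `q` are reversed because `g j` is `z ^ (m - 1 - j)`.
  refine ⟨Matrix.of fun _ b => if (⟨0, hn⟩ : Fin n) = (finProdFinEquiv.symm b).2
      then p.coeff (finProdFinEquiv.symm b).1 else 0,
    Matrix.of fun a _ => if (⟨0, hn⟩ : Fin n) = (finProdFinEquiv.symm a).2
      then q.coeff (m - 1 - (finProdFinEquiv.symm a).1) else 0, fun a b => ?_⟩
  rw [encodeProd_apply]
  simp only [encodeLeft_apply, encodeRight_apply, Matrix.of_apply, Equiv.symm_apply_apply, hf, hg]
  rw [Finset.sum_eq_single (⟨0, hn⟩ : Fin n) (fun c _ hc => by simp [hc.symm])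
    fun h => absurd (Finset.mem_univ _) h]
  simp only [if_true]
  rw [map_mul]
  congr 1
  · rw [Polynomial.aeval_eq_sum_range' hp, ← Fin.sum_univ_eq_sum_range
      (fun i => p.coeff i • z ^ i)]
    exact Finset.sum_congr rfl fun i _ => by rw [Algebra.smul_def, mul_comm]
  · rw [Polynomial.aeval_eq_sum_range' hq, ← Finset.sum_range_reflect, ← Fin.sum_univ_eq_sum_range
      (fun i => q.coeff (m - 1 - i) • z ^ (m - 1 - i))]
    exact Finset.sum_congr rfl fun i _ => by rw [Algebra.smul_def, mul_comm]

end Matrices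

/-! ### Recovery from enough places, and failure for paired places -/

section Recovery

variable {k F : Type*} [Field k] [Field F] [Algebra k F]
  [Algebra (RatFunc k) F] [IsScalarTower k (RatFunc k) F] [FunctionField k F]

/-- A nonzero `x` would lie in the space of `n (z)_∞` minus the places of `S`, a divisor of negative
degree. -/
theorem IsGenus.eq_zero_of_eval_eq_zero {γ : ℤ} (hγ : IsGenus k F γ) [Nonempty (Place k F)]
    {z x : F} (hz : polesDegree k (fun _ : Unit => z) ≠ 0) {n : ℕ}
    (hx : ∀ P : Place k F, P.poleOrder x ≤ n * P.poleOrder z) {S : Finset (Place k F)}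
    (hS : ∀ P ∈ S, P.degree = 1 ∧ z ∈ P.ring)
    (hcard : n * polesDegree k (fun _ : Unit => z) < S.card)
    (h0 : ∀ P ∈ S, P.eval x = 0) : x = 0 := by
  classical
  by_contra hx0
  have hzfin := finite_poles_of_polesDegree_ne_zero hz
  have h1 := hγ.degree_nonneg_of_mem hx0
    (D := (n : ℤ) • poleDivisor (fun _ : Unit => z) hzfin - ∑ P ∈ S, Finsupp.single P (1 : ℤ))
    (mem_riemannRochSpace.2 fun P => by
      rw [Finsupp.sub_apply, sum_single_apply, Finsupp.smul_apply, poleDivisor_unit_apply,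
        smul_eq_mul, ← Nat.cast_mul]
      have hle := P.poleOrder_le_iff.1 (hx P)
      split_ifs with hPS
      · have hzP := P.poleOrder_eq_zero_iff.2 (hS P hPS).2
        have hxP : x ∈ P.ring := by
          have := hx P
          rw [hzP, mul_zero] at this
          exact P.poleOrder_eq_zero_iff.1 (Nat.le_zero.1 this)
        rw [hzP, mul_zero, Nat.cast_zero, zero_sub]
        exact P.val_le_exp_neg_one_of_lt ((P.eval_eq_zero_iff hxP).1 (h0 P hPS))
      · rwa [sub_zero])
  rw [Divisor.degree_sub, Divisor.degree_smul, Divisor.degree_sum_single,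
    ← polesDegree_eq_degree, Finset.sum_congr rfl fun P hP => by rw [(hS P hP).1]] at h1
  simp at h1
  zify at hcard
  linarith

end Recovery

/-- Every finite set of at most `2 (m - 1)` constants is the zero set of a product of two
polynomials of degree less than `m`. -/
theorem exists_mul_ne_zero_and_eval_eq_zero {k : Type*} [Field k] {m : ℕ} (hm : 1 ≤ m)
    (T : Finset k) (hT : T.card ≤ 2 * (m - 1)) :
    ∃ p q : Polynomial k, p.natDegree < m ∧ q.natDegree < m ∧ p * q ≠ 0 ∧
      ∀ c ∈ T, (p * q).eval c = 0 := by
  classical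
  -- `T₁` takes up to `m - 1` of the roots; at most `m - 1` remain for the second factor.
  obtain ⟨T₁, hT₁, hcard⟩ := Finset.exists_subset_card_eq (s := T) (n := min T.card (m - 1))
    (min_le_left _ _)
  have hcard₂ := Finset.card_sdiff_add_card_eq_card hT₁
  refine ⟨∏ c ∈ T₁, (Polynomial.X - Polynomial.C c),
    ∏ c ∈ T \ T₁, (Polynomial.X - Polynomial.C c), ?_, ?_, ?_, fun c hc => ?_⟩
  · rw [Polynomial.natDegree_finsetProd_X_sub_C_eq_card]
    omega
  · rw [Polynomial.natDegree_finsetProd_X_sub_C_eq_card]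
    omega
  · exact mul_ne_zero (Polynomial.monic_prod_X_sub_C _ _).ne_zero
      (Polynomial.monic_prod_X_sub_C _ _).ne_zero
  · rw [mul_comm, Finset.prod_sdiff hT₁, Polynomial.eval_prod]
    exact Finset.prod_eq_zero hc (by simp)

/-- Rational places that come in pairs with the same value of `z` give at most half as many
values. -/
theorem exists_finset_values {k F : Type*} [Field k] [Field F] [Algebra k F] {z : F}
    {S : Finset (Place k F)}
    (hS : ∀ P ∈ S, ∃ P' ∈ S, P' ≠ P ∧ ∃ c : k,
      P.eval z = algebraMap k P.Residue c ∧ P'.eval z = algebraMap k P'.Residue c) :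
    ∃ T : Finset k, 2 * T.card ≤ S.card ∧
      ∀ P ∈ S, ∃ c ∈ T, P.eval z = algebraMap k P.Residue c := by
  classical
  let v : Place k F → k := fun P =>
    if h : ∃ c : k, P.eval z = algebraMap k P.Residue c then h.choose else 0
  have hv : ∀ (P : Place k F) (c : k), P.eval z = algebraMap k P.Residue c → v P = c := by
    intro P c hc
    have h : ∃ c : k, P.eval z = algebraMap k P.Residue c := ⟨c, hc⟩
    simp only [v, dif_pos h]
    exact (algebraMap k P.Residue).injective (h.choose_spec.symm.trans hc)
  refine ⟨S.image v, ?_, fun P hP => ?_⟩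
  -- Every fibre of `v` on `S` contains a place and its partner.
  · refine Finset.mul_card_image_le_card S 2 fun c hc => ?_
    obtain ⟨P, hP, rfl⟩ := Finset.mem_image.1 hc
    obtain ⟨P', hP', hne, c, h1, h2⟩ := hS P hP
    have h3 : 1 < (S.filter fun x => v x = v P).card :=
      Finset.one_lt_card.2 ⟨P, by simp [hP], P', by simp [hP', hv P c h1, hv P' c h2], hne.symm⟩
    exact h3
  · obtain ⟨P', hP', hne, c, h1, h2⟩ := hS P hP
    exact ⟨c, Finset.mem_image.2 ⟨P, hP, hv P c h1⟩, h1⟩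

end

end MatdotAG

/-! ### The main theorem -/

theorem mainTheorem6
    {k F : Type*} [Field k] [Finite k] [Field F] [Algebra k F]
    [Algebra (RatFunc k) F] [IsScalarTower k (RatFunc k) F] [FunctionField k F]
    (m : ℕ) (hm : 1 ≤ m) (Q : MatdotAG.Place k F) (z : F)
    (hF : MatdotAG.IsFriendly m Q z) (γ : ℤ) (hγ : MatdotAG.IsGenus k F γ)
    (f g : Fin m → F)
    (hf : ∀ i, f i = z ^ (i : ℕ)) (hg : ∀ j, g j = z ^ (m - 1 - (j : ℕ))) :
    -- `v_Q(f_i g_j) = m - 1` exactly on the diagonal, so this is a Matdot AG code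
    (∀ i j, Q.ord (f i * g j) = (((m : ℤ) - 1 : ℤ) : WithTop ℤ) ↔ i = j) ∧
    MatdotAG.IsMatdotCode Q f g ∧
    -- its recovery threshold
    (MatdotAG.recoveryThreshold k f g : ℤ) = 2 * γ + 2 * m - 1 ∧
    -- the threshold is the least one among all Matdot AG codes over `F`
    IsLeast {R : ℤ | ∃ (Q' : MatdotAG.Place k F) (f' g' : Fin m → F),
        MatdotAG.IsMatdotCode Q' f' g' ∧ R = MatdotAG.recoveryThreshold k f' g'}
      (2 * γ + 2 * m - 1) ∧
    -- what this means for matrices `A` and `B` of any sizes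
    ∀ r n t : ℕ,
      -- `A B` is the coefficient of `z ^ (m - 1)` in `h`
      (∀ (A : Matrix (Fin r) (Fin (m * n)) k) (B : Matrix (Fin (m * n)) (Fin t) k),
        ∃ C : Fin (2 * m - 1) → Matrix (Fin r) (Fin t) k,
          MatdotAG.encodeProd f g A B
            = ∑ l : Fin (2 * m - 1), z ^ (l : ℕ) • (C l).map (algebraMap k F) ∧
          C ⟨m - 1, by omega⟩ = A * B ∧
          ∀ C' : Fin (2 * m - 1) → Matrix (Fin r) (Fin t) k,
            MatdotAG.encodeProd f g A B
              = ∑ l : Fin (2 * m - 1), z ^ (l : ℕ) • (C' l).map (algebraMap k F) → C' = C) ∧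
      -- `deg (h)_∞ + 1` is at most the threshold, with equality if `A_m B_1 ≠ 0`
      (∀ (A : Matrix (Fin r) (Fin (m * n)) k) (B : Matrix (Fin (m * n)) (Fin t) k),
        (MatdotAG.polesDegree k
            (fun p : Fin r × Fin t => MatdotAG.encodeProd f g A B p.1 p.2) : ℤ) + 1
          ≤ 2 * γ + 2 * m - 1 ∧
        (MatdotAG.blockCol A ⟨m - 1, by omega⟩ * MatdotAG.blockRow B ⟨0, hm⟩ ≠ 0 →
          (MatdotAG.polesDegree k
              (fun p : Fin r × Fin t => MatdotAG.encodeProd f g A B p.1 p.2) : ℤ) + 1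
            = 2 * γ + 2 * m - 1)) ∧
      -- the answers at any `2γ + 2m - 1` rational places that are no poles of `z`
      -- determine `h` and `A B`
      (∀ S : Finset (MatdotAG.Place k F),
        (∀ P ∈ S, P.degree = 1 ∧ z ∈ P.ring) → 2 * γ + 2 * m - 1 ≤ (S.card : ℤ) →
        ∀ (A A' : Matrix (Fin r) (Fin (m * n)) k) (B B' : Matrix (Fin (m * n)) (Fin t) k),
          (∀ P ∈ S, MatdotAG.response f g P A B = MatdotAG.response f g P A' B') →
          MatdotAG.encodeProd f g A B = MatdotAG.encodeProd f g A' B' ∧ A * B = A' * B') ∧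
      -- fewer answers do not suffice in general: fewer than `2γ + 2m - 1` rational places that
      -- come in pairs with the same value of `z` never determine `h`
      (1 ≤ r → 1 ≤ n → 1 ≤ t → ∀ S : Finset (MatdotAG.Place k F),
        (∀ P ∈ S, P.degree = 1 ∧ z ∈ P.ring ∧ ∃ P' ∈ S, P' ≠ P ∧ ∃ c : k,
          P.eval z = algebraMap k P.Residue c ∧ P'.eval z = algebraMap k P'.Residue c) →
        (S.card : ℤ) < 2 * γ + 2 * m - 1 →
        ∃ (A A' : Matrix (Fin r) (Fin (m * n)) k) (B B' : Matrix (Fin (m * n)) (Fin t) k),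
          (∀ P ∈ S, MatdotAG.response f g P A B = MatdotAG.response f g P A' B') ∧
          MatdotAG.encodeProd f g A B ≠ MatdotAG.encodeProd f g A' B') := by
  obtain rfl : γ = (m : ℤ) - 1 := hγ.unique hF.genus
  have : Nonempty (MatdotAG.Place k F) := ⟨Q⟩
  have hz := hF.transcendental
  have hpoles := hF.poles
  have hpoles0 : MatdotAG.polesDegree k (fun _ : Unit => z) ≠ 0 := by rw [hpoles]; norm_num
  have hvz := Q.ord_eq_coe_iff.1 hF.ord_eq
  have hfg : ∀ i j, f i * g j = z ^ ((i : ℕ) + (m - 1 - (j : ℕ))) := fun i j => by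
    rw [hf, hg, pow_add]
  have hcode : ∀ i j, Q.ord (f i * g j) = (((m : ℤ) - 1 : ℤ) : WithTop ℤ) ↔ i = j := by
    intro i j
    rw [Q.ord_eq_coe_iff, hfg, map_pow, hvz, ← WithZero.exp_nsmul, WithZero.exp_inj, Fin.ext_iff]
    simp only [nsmul_eq_mul]
    omega
  have hR : (MatdotAG.recoveryThreshold k f g : ℤ) = 2 * ((m : ℤ) - 1) + 2 * m - 1 := by
    have h1 := MatdotAG.polesDegree_eq_mul hpoles0 (n := 2 * m - 2)
      (x := fun p : Fin m × Fin m => f p.1 * g p.2)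
      (fun P p => by
        rw [hfg, P.poleOrder_pow]
        exact Nat.mul_le_mul_right _ (by omega))
      -- This product is `z ^ (2m - 2)`, whose poles dominate those of all the others.
      (i := (⟨m - 1, by omega⟩, ⟨0, hm⟩))
      (fun P => by
        rw [hfg, P.poleOrder_pow]
        congr 1
        simp only
        omega)
    rw [MatdotAG.recoveryThreshold, h1, hpoles]
    omega
  have hle : ∀ {r n t : ℕ} (A : Matrix (Fin r) (Fin (m * n)) k)
      (B : Matrix (Fin (m * n)) (Fin t) k) a b (P : MatdotAG.Place k F),
      P.poleOrder (MatdotAG.encodeProd f g A B a b) ≤ (2 * m - 2) * P.poleOrder z := by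
    intro r n t A B a b P
    rw [MatdotAG.encodeProd_apply_eq_sum hf hg]
    exact P.poleOrder_sum_le z (by omega) _
  have hmem : ∀ {P : MatdotAG.Place k F}, z ∈ P.ring →
      (∀ i, f i ∈ P.ring) ∧ ∀ i, g i ∈ P.ring := fun hzP =>
    ⟨fun i => hf i ▸ pow_mem hzP _, fun i => hg i ▸ pow_mem hzP _⟩
  have hresp : ∀ {P : MatdotAG.Place k F}, z ∈ P.ring → ∀ {r n t : ℕ}
      (A : Matrix (Fin r) (Fin (m * n)) k) (B : Matrix (Fin (m * n)) (Fin t) k) a b,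
      MatdotAG.response f g P A B a b = P.eval (MatdotAG.encodeProd f g A B a b) ∧
        MatdotAG.encodeProd f g A B a b ∈ P.ring := by
    intro P hzP r n t A B a b
    rw [MatdotAG.response_eq_map_eval P (hmem hzP).1 (hmem hzP).2]
    refine ⟨rfl, P.poleOrder_eq_zero_iff.1 (Nat.le_zero.1 ?_)⟩
    have h := hle A B a b P
    rwa [P.poleOrder_eq_zero_iff.2 hzP, mul_zero] at h
  refine ⟨hcode, ⟨_, hcode⟩, hR, ⟨⟨Q, f, g, ⟨_, hcode⟩, hR.symm⟩, ?_⟩,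
    fun r n t => ⟨?_, ?_, ?_, ?_⟩⟩
  · rintro R ⟨Q', f', g', h, rfl⟩
    have h1 := hF.le_polesDegree_of_isMatdotCode hm h
    rw [MatdotAG.recoveryThreshold]
    push_cast
    linarith
  · intro A B
    have h := MatdotAG.encodeProd_eq_sum hf hg A B
    exact ⟨MatdotAG.prodCoeff A B, h, MatdotAG.prodCoeff_diagonal _ A B, fun C' hC' =>
      MatdotAG.eq_of_sum_pow_smul_map_eq hz (hC'.symm.trans h)⟩
  · intro A B
    constructor
    · have h := (MatdotAG.polesDegree_le_mul hpoles0
        (x := fun p : Fin r × Fin t => MatdotAG.encodeProd f g A B p.1 p.2)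
        fun P p => hle A B p.1 p.2 P).2
      rw [hpoles] at h
      omega
    · intro hAB
      obtain ⟨a, b, hab⟩ : ∃ a b, MatdotAG.prodCoeff A B ⟨2 * m - 2, by omega⟩ a b ≠ 0 := by
        rw [MatdotAG.prodCoeff_last _ (by omega) hm]
        by_contra! h
        exact hAB (Matrix.ext h)
      have h := MatdotAG.polesDegree_eq_mul hpoles0
        (x := fun p : Fin r × Fin t => MatdotAG.encodeProd f g A B p.1 p.2)
        (fun P p => hle A B p.1 p.2 P) (i := (a, b)) fun P => by
          simp only
          rw [MatdotAG.encodeProd_apply_eq_sum hf hg]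
          exact P.poleOrder_sum_eq z _ ⟨2 * m - 2, by omega⟩ (by simp only; omega) hab
      rw [hpoles] at h
      omega
  · intro S hS hcard A A' B B' hAB
    have h : MatdotAG.encodeProd f g A B = MatdotAG.encodeProd f g A' B' := by
      ext a b
      rw [← sub_eq_zero]
      refine hγ.eq_zero_of_eval_eq_zero hpoles0 (n := 2 * m - 2) (fun P => ?_) hS
        (by rw [hpoles]; omega) fun P hP => ?_
      · rw [P.poleOrder_le_iff]
        exact P.val.map_sub_le (P.poleOrder_le_iff.1 (hle A B a b P))
          (P.poleOrder_le_iff.1 (hle A' B' a b P))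
      · have h1 := hresp (hS P hP).2 A B a b
        have h2 := hresp (hS P hP).2 A' B' a b
        rw [P.eval_sub h1.2 h2.2, ← h1.1, ← h2.1, hAB P hP, sub_self]
    refine ⟨h, ?_⟩
    rw [MatdotAG.encodeProd_eq_sum hf hg, MatdotAG.encodeProd_eq_sum hf hg] at h
    rw [← MatdotAG.prodCoeff_diagonal (by omega), ← MatdotAG.prodCoeff_diagonal (by omega),
      MatdotAG.eq_of_sum_pow_smul_map_eq hz h]
  · intro hr hn ht S hS hcard
    obtain ⟨T, hT, hTS⟩ := MatdotAG.exists_finset_values fun P hP => (hS P hP).2.2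
    -- Here `|S| ≤ 4m - 4`, so pairing leaves at most `2m - 2` values.
    obtain ⟨p, q, hp, hq, hpq, hzero⟩ :=
      MatdotAG.exists_mul_ne_zero_and_eval_eq_zero hm T (by omega)
    obtain ⟨A, B, hAB⟩ := MatdotAG.exists_encodeProd_eq_aeval_mul (r := r) (t := t) hf hg hn hp hq
    have hm0 : (0 : Polynomial k).natDegree < m := by rw [Polynomial.natDegree_zero]; exact hm
    -- The competing pair has `h = 0`, which agrees with `p(z) q(z)` at every place of `S`.
    obtain ⟨A', B', hAB'⟩ := MatdotAG.exists_encodeProd_eq_aeval_mul (r := r) (t := t) hf hg hn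
      (p := 0) (q := 0) hm0 hm0
    refine ⟨A, A', B, B', fun P hP => ?_, fun h => ?_⟩
    · ext a b
      obtain ⟨c, hcT, hc⟩ := hTS P hP
      rw [(hresp (hS P hP).2.1 A B a b).1, (hresp (hS P hP).2.1 A' B' a b).1, hAB, hAB',
        P.eval_aeval (hS P hP).2.1, P.eval_aeval (hS P hP).2.1, hc,
        Polynomial.aeval_algebraMap_apply, Polynomial.coe_aeval_eq_eval, hzero c hcT]
      simp
    · have h1 := hAB ⟨0, hr⟩ ⟨0, ht⟩
      rw [h, hAB', mul_zero, map_zero] at h1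
      exact hpq (transcendental_iff.1 hz _ h1.symm)
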